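/- Let $(\Omega,\mathcal F,\mathbb P)$ be a probability space and $(w_k)_{k\ge0}$ independent real random variables with $\mathbb E w_k=0$ and $\mathbb E(w_kw_s)=\delta_{ks}$. Let $A,C\in\mathbb R^{n\times n}$, $B,D\in\mathbb R^{n\times m}$, let $Q\in\mathbb R^{n\times n}$ be symmetric positive semidefinite and $R\in\mathbb R^{m\times m}$ symmetric positive definite, and put $\Lambda=\begin{bmatrix}Q&0\\0&R\end{bmatrix}$. For $F\in\mathbb R^{m\times n}$ and $z\in\mathbb R^n$ let $x^{F,z}_0=z$ and $$x^{F,z}_{k+1}=(A+BF)x^{F,z}_k+(C+DF)x^{F,z}_kw_k ,\qquad J(z,F)=\mathbb E\sum_{k=0}^\infty\begin{bmatrix}x^{F,z}_k\\Fx^{F,z}_k\end{bmatrix}'\Lambda\begin{bmatrix}x^{F,z}_k\\Fx^{F,z}_k\end{bmatrix}\in[0,\infty].$$ Let $\mathscr F$ be the set of stabilizing gains, i.e. of those $F$ with $\lim_{k\to\infty}\mathbb E\|x^{F,z}_k\|^2=0$ for every $z\in\mathbb R^n$. Assume: - the system is stabilizable, i.e. $\mathscr F\ne\emptyset$; - $(A,C|Q)$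 is exactly observable or exactly detectable. Here, with $x_{k+1}=Ax_k+Cx_kw_k$, exact observability (exact detectability) means that there is an integer $T\ge1$ such that, for every $x_0\in\mathbb R^n$, if $Qx_k=0$ almost surely for all $k=0,\dots,T$, then $x_0=0$ (then $\lim_{k\to\infty}\mathbb E\|x_k\|^2=0$, respectively). Let $z_1,\dots,z_r\in\mathbb R^n$ be such that $Z=\sum_{l=1}^rz_lz_l'$ is positive definite, and put $\hat J(F)=\sum_{l=1}^rJ(z_l,F)$. Problem (SLQR) is to minimize $\hat J(F)$ over $F\in\mathscr F$. With $$A_F=\begin{bmatrix}A&B\\FA&FB\end{bmatrix},\qquad C_F=\begin{bmatrix}C&D\\FC&FD\end{bmatrix},$$ and with $\mathscr S_{n+m}$ the set of real symmetric $(n+m)\times(n+m)$ matrices, let $$J_{\mathcal P_1}=\inf\Big\{\operatorname{Tr}(\Lambda S):S\in\mathscr S_{n+m},\ F\in\mathscr F,\ A_FSA_F'+C_FSC_F'+\begin{bmatrix}I_n\\F\end{bmatrix}Z\begin{bmatrix}I_n\\F\end{bmatrix}'=S\Big\},$$ $$J_{\mathcal P_2}=\inf\Big\{\operatorname{Tr}\Big(\begin{bmatrix}I_n\\F\end{bmatrix}Z\begin{bmatrix}I_n\\F\end{bmatrix}'X\Big):X\in\mathscr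 S_{n+m},\ F\in\mathscr F,\ A_F'XA_F+C_F'XC_F+\Lambda-X=0\Big\},$$ the latter being the value of problem ($\mathcal P_2$-SLQR). Then Problem (SLQR) has exactly one solution $F^*$, and it is given by $F^*=-(R+B'P^*B+D'P^*D)^{-1}(B'P^*A+D'P^*C)$, where $P^*$ is the unique symmetric positive semidefinite solution of $$A'PA+C'PC+Q-(A'PB+C'PD)(R+B'PB+D'PD)^{-1}(B'PA+D'PC)=P.$$ Problem ($\mathcal P_2$-SLQR) has exactly one optimal solution $(X^*_{\mathcal P_2},F^*_{\mathcal P_2})$, and $$J_{\mathcal P_2}=\hat J(F^*)=J_{\mathcal P_1},\qquad F^*_{\mathcal P_2}=F^*.$$ -/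

import Mathlib

open MeasureTheory ProbabilityTheory Filter Topology
open scoped ENNReal Matrix

namespace SLQR

/-- The driving noise: independent real random variables with `E w_k = 0` and
`E (w_k w_s) = δ_{ks}`. -/
structure IsUnitWhiteNoise {Ω : Type*} [MeasurableSpace Ω] (μ : Measure Ω)
    (w : ℕ → Ω → ℝ) : Prop where
  measurable : ∀ k, Measurable (w k)
  memLp : ∀ k, MemLp (w k) 2 μ
  indep : iIndepFun w μ
  mean : ∀ k, ∫ ω, w k ω ∂μ = 0
  cov : ∀ k s, ∫ ω, w k ω * w s ω ∂μ = if k = s then 1 else 0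

/-- The trajectory of `x_{k+1} = A x_k + (C x_k) w_k`, `x_0 = z`. -/
def traj {Ω : Type*} {n : ℕ} (w : ℕ → Ω → ℝ) (A C : Matrix (Fin n) (Fin n) ℝ)
    (z : Fin n → ℝ) : ℕ → Ω → (Fin n → ℝ)
  | 0 => fun _ => z
  | k + 1 => fun ω => A *ᵥ traj w A C z k ω + w k ω • (C *ᵥ traj w A C z k ω)

/-- `E (x_k' x_k)`, as a `[0, ∞]`-valued expectation. -/
noncomputable def meanSquare {Ω : Type*} [MeasurableSpace Ω] (μ : Measure Ω) {n : ℕ}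
    (w : ℕ → Ω → ℝ) (A C : Matrix (Fin n) (Fin n) ℝ) (z : Fin n → ℝ) (k : ℕ) : ℝ≥0∞ :=
  ∫⁻ ω, ENNReal.ofReal (traj w A C z k ω ⬝ᵥ traj w A C z k ω) ∂μ

/-- `[A; C]` is asymptotically mean square stable (ASMS). -/
def ASMS {Ω : Type*} [MeasurableSpace Ω] (μ : Measure Ω) {n : ℕ}
    (w : ℕ → Ω → ℝ) (A C : Matrix (Fin n) (Fin n) ℝ) : Prop :=
  ∀ z : Fin n → ℝ, Tendsto (meanSquare μ w A C z) atTop (𝓝 0)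

/-- The set of stabilizing gains: those `F` for which `[A + B F; C + D F]` is ASMS. -/
def stabilizingGains {Ω : Type*} [MeasurableSpace Ω] (μ : Measure Ω) {n m : ℕ}
    (w : ℕ → Ω → ℝ) (A : Matrix (Fin n) (Fin n) ℝ) (B : Matrix (Fin n) (Fin m) ℝ)
    (C : Matrix (Fin n) (Fin n) ℝ) (D : Matrix (Fin n) (Fin m) ℝ) :
    Set (Matrix (Fin m) (Fin n) ℝ) :=
  {F | ASMS μ w (A + B * F) (C + D * F)}

/-- `[A, B; C, D]` is stabilizable. -/
def Stabilizable {Ω : Type*} [MeasurableSpace Ω] (μ : Measure Ω) {n m : ℕ}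
    (w : ℕ → Ω → ℝ) (A : Matrix (Fin n) (Fin n) ℝ) (B : Matrix (Fin n) (Fin m) ℝ)
    (C : Matrix (Fin n) (Fin n) ℝ) (D : Matrix (Fin n) (Fin m) ℝ) : Prop :=
  ∃ F : Matrix (Fin m) (Fin n) ℝ, F ∈ stabilizingGains μ w A B C D

/-- `(A, C | Q)` is exactly observable: for some `T ≥ 1`, only `x_0 = 0` produces an output
`y_k = Q x_k` that vanishes almost surely for all `k ∈ {0, …, T}`. -/
def ExactlyObservable {Ω : Type*} [MeasurableSpace Ω] (μ : Measure Ω) {n : ℕ}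
    (w : ℕ → Ω → ℝ) (A C Q : Matrix (Fin n) (Fin n) ℝ) : Prop :=
  ∃ T : ℕ, 0 < T ∧ ∀ z : Fin n → ℝ,
    (∀ k ≤ T, ∀ᵐ ω ∂μ, Q *ᵥ traj w A C z k ω = 0) → z = 0

/-- `(A, C | Q)` is exactly detectable: for some `T ≥ 1`, each trajectory whose output
`y_k = Q x_k` vanishes almost surely for all `k ∈ {0, …, T}` tends to `0` in mean square. -/
def ExactlyDetectable {Ω : Type*} [MeasurableSpace Ω] (μ : Measure Ω) {n : ℕ}
    (w : ℕ → Ω → ℝ) (A C Q : Matrix (Fin n) (Fin n) ℝ) : Prop :=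
  ∃ T : ℕ, 0 < T ∧ ∀ z : Fin n → ℝ,
    (∀ k ≤ T, ∀ᵐ ω ∂μ, Q *ᵥ traj w A C z k ω = 0) →
      Tendsto (meanSquare μ w A C z) atTop (𝓝 0)

/-- `Λ = diag(Q, R)`. -/
def costMatrix {n m : ℕ} (Q : Matrix (Fin n) (Fin n) ℝ) (R : Matrix (Fin m) (Fin m) ℝ) :
    Matrix (Fin n ⊕ Fin m) (Fin n ⊕ Fin m) ℝ :=
  Matrix.fromBlocks Q 0 0 R

/-- `J(z, F) = E ∑_k [x_k; F x_k]' Λ [x_k; F x_k]` along the closed loop with gain `F` started at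
`z`. For `Q, R` positive semidefinite the summands are nonnegative, so that this `[0, ∞]`-valued
expectation is the expected cost. -/
noncomputable def cost {Ω : Type*} [MeasurableSpace Ω] (μ : Measure Ω) {n m : ℕ}
    (w : ℕ → Ω → ℝ) (A : Matrix (Fin n) (Fin n) ℝ) (B : Matrix (Fin n) (Fin m) ℝ)
    (C : Matrix (Fin n) (Fin n) ℝ) (D : Matrix (Fin n) (Fin m) ℝ)
    (Q : Matrix (Fin n) (Fin n) ℝ) (R : Matrix (Fin m) (Fin m) ℝ)
    (z : Fin n → ℝ) (F : Matrix (Fin m) (Fin n) ℝ) : ℝ≥0∞ :=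
  ∫⁻ ω, ∑' k : ℕ,
    (let x := traj w (A + B * F) (C + D * F) z k ω
     let v := Sum.elim x (F *ᵥ x)
     ENNReal.ofReal (v ⬝ᵥ (costMatrix Q R *ᵥ v))) ∂μ

/-- `Ĵ(z_1, …, z_r, F) = ∑_l J(z_l, F)`. -/
noncomputable def totalCost {Ω : Type*} [MeasurableSpace Ω] (μ : Measure Ω) {n m r : ℕ}
    (w : ℕ → Ω → ℝ) (A : Matrix (Fin n) (Fin n) ℝ) (B : Matrix (Fin n) (Fin m) ℝ)
    (C : Matrix (Fin n) (Fin n) ℝ) (D : Matrix (Fin n) (Fin m) ℝ)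
    (Q : Matrix (Fin n) (Fin n) ℝ) (R : Matrix (Fin m) (Fin m) ℝ)
    (z : Fin r → Fin n → ℝ) (F : Matrix (Fin m) (Fin n) ℝ) : ℝ≥0∞ :=
  ∑ l, cost μ w A B C D Q R (z l) F

/-- `F` solves Problem (SLQR): it minimizes `Ĵ` over the stabilizing gains. -/
def IsSLQROptimal {Ω : Type*} [MeasurableSpace Ω] (μ : Measure Ω) {n m r : ℕ}
    (w : ℕ → Ω → ℝ) (A : Matrix (Fin n) (Fin n) ℝ) (B : Matrix (Fin n) (Fin m) ℝ)
    (C : Matrix (Fin n) (Fin n) ℝ) (D : Matrix (Fin n) (Fin m) ℝ)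
    (Q : Matrix (Fin n) (Fin n) ℝ) (R : Matrix (Fin m) (Fin m) ℝ)
    (z : Fin r → Fin n → ℝ) (F : Matrix (Fin m) (Fin n) ℝ) : Prop :=
  F ∈ stabilizingGains μ w A B C D ∧
    ∀ F' ∈ stabilizingGains μ w A B C D,
      totalCost μ w A B C D Q R z F ≤ totalCost μ w A B C D Q R z F'

/-- `Z = ∑_l z_l z_l'`. -/
def initMatrix {n r : ℕ} (z : Fin r → Fin n → ℝ) : Matrix (Fin n) (Fin n) ℝ :=
  ∑ l, Matrix.vecMulVec (z l) (z l)

/-- `[I; F] Z [I; F]'`. -/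
def augInit {n m : ℕ} (Z : Matrix (Fin n) (Fin n) ℝ) (F : Matrix (Fin m) (Fin n) ℝ) :
    Matrix (Fin n ⊕ Fin m) (Fin n ⊕ Fin m) ℝ :=
  Matrix.fromRows 1 F * Z * (Matrix.fromRows 1 F)ᵀ

/-- The augmented matrix `A_F = [A, B; F A, F B]` (and `C_F`, when applied to `C`, `D`). -/
def aug {n m : ℕ} (A : Matrix (Fin n) (Fin n) ℝ) (B : Matrix (Fin n) (Fin m) ℝ)
    (F : Matrix (Fin m) (Fin n) ℝ) : Matrix (Fin n ⊕ Fin m) (Fin n ⊕ Fin m) ℝ :=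
  Matrix.fromBlocks A B (F * A) (F * B)

/-- `(S, F)` is feasible for Primal Problem I. -/
def P1Feasible {Ω : Type*} [MeasurableSpace Ω] (μ : Measure Ω) {n m : ℕ}
    (w : ℕ → Ω → ℝ) (A : Matrix (Fin n) (Fin n) ℝ) (B : Matrix (Fin n) (Fin m) ℝ)
    (C : Matrix (Fin n) (Fin n) ℝ) (D : Matrix (Fin n) (Fin m) ℝ)
    (Z : Matrix (Fin n) (Fin n) ℝ)
    (S : Matrix (Fin n ⊕ Fin m) (Fin n ⊕ Fin m) ℝ) (F : Matrix (Fin m) (Fin n) ℝ) : Prop :=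
  S.IsSymm ∧
    aug A B F * S * (aug A B F)ᵀ + aug C D F * S * (aug C D F)ᵀ + augInit Z F = S ∧
    F ∈ stabilizingGains μ w A B C D

/-- The value of Primal Problem I: the infimum of `Tr (Λ S)` over the feasible pairs. -/
noncomputable def P1Value {Ω : Type*} [MeasurableSpace Ω] (μ : Measure Ω) {n m : ℕ}
    (w : ℕ → Ω → ℝ) (A : Matrix (Fin n) (Fin n) ℝ) (B : Matrix (Fin n) (Fin m) ℝ)
    (C : Matrix (Fin n) (Fin n) ℝ) (D : Matrix (Fin n) (Fin m) ℝ)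
    (Q : Matrix (Fin n) (Fin n) ℝ) (R : Matrix (Fin m) (Fin m) ℝ)
    (Z : Matrix (Fin n) (Fin n) ℝ) : EReal :=
  ⨅ (S : Matrix (Fin n ⊕ Fin m) (Fin n ⊕ Fin m) ℝ) (F : Matrix (Fin m) (Fin n) ℝ)
    (_ : P1Feasible μ w A B C D Z S F), ((costMatrix Q R * S).trace : EReal)

/-- `(X, F)` is feasible for Primal Problem II. -/
def P2Feasible {Ω : Type*} [MeasurableSpace Ω] (μ : Measure Ω) {n m : ℕ}
    (w : ℕ → Ω → ℝ) (A : Matrix (Fin n) (Fin n) ℝ) (B : Matrix (Fin n) (Fin m) ℝ)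
    (C : Matrix (Fin n) (Fin n) ℝ) (D : Matrix (Fin n) (Fin m) ℝ)
    (Q : Matrix (Fin n) (Fin n) ℝ) (R : Matrix (Fin m) (Fin m) ℝ)
    (X : Matrix (Fin n ⊕ Fin m) (Fin n ⊕ Fin m) ℝ) (F : Matrix (Fin m) (Fin n) ℝ) : Prop :=
  X.IsSymm ∧
    (aug A B F)ᵀ * X * aug A B F + (aug C D F)ᵀ * X * aug C D F + costMatrix Q R - X = 0 ∧
    F ∈ stabilizingGains μ w A B C D

/-- The objective of Primal Problem II, `Tr ([I; F] Z [I; F]' X)`. -/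
def P2Objective {n m : ℕ} (Z : Matrix (Fin n) (Fin n) ℝ)
    (X : Matrix (Fin n ⊕ Fin m) (Fin n ⊕ Fin m) ℝ) (F : Matrix (Fin m) (Fin n) ℝ) : ℝ :=
  (augInit Z F * X).trace

/-- The value of Primal Problem II: the infimum of the objective over the feasible pairs. -/
noncomputable def P2Value {Ω : Type*} [MeasurableSpace Ω] (μ : Measure Ω) {n m : ℕ}
    (w : ℕ → Ω → ℝ) (A : Matrix (Fin n) (Fin n) ℝ) (B : Matrix (Fin n) (Fin m) ℝ)
    (C : Matrix (Fin n) (Fin n) ℝ) (D : Matrix (Fin n) (Fin m) ℝ)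
    (Q : Matrix (Fin n) (Fin n) ℝ) (R : Matrix (Fin m) (Fin m) ℝ)
    (Z : Matrix (Fin n) (Fin n) ℝ) : EReal :=
  ⨅ (X : Matrix (Fin n ⊕ Fin m) (Fin n ⊕ Fin m) ℝ) (F : Matrix (Fin m) (Fin n) ℝ)
    (_ : P2Feasible μ w A B C D Q R X F), (P2Objective Z X F : EReal)

/-- `(X, F)` is an optimal solution of Primal Problem II. -/
def IsP2Optimal {Ω : Type*} [MeasurableSpace Ω] (μ : Measure Ω) {n m : ℕ}
    (w : ℕ → Ω → ℝ) (A : Matrix (Fin n) (Fin n) ℝ) (B : Matrix (Fin n) (Fin m) ℝ)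
    (C : Matrix (Fin n) (Fin n) ℝ) (D : Matrix (Fin n) (Fin m) ℝ)
    (Q : Matrix (Fin n) (Fin n) ℝ) (R : Matrix (Fin m) (Fin m) ℝ)
    (Z : Matrix (Fin n) (Fin n) ℝ)
    (X : Matrix (Fin n ⊕ Fin m) (Fin n ⊕ Fin m) ℝ) (F : Matrix (Fin m) (Fin n) ℝ) : Prop :=
  P2Feasible μ w A B C D Q R X F ∧
    ∀ X' F', P2Feasible μ w A B C D Q R X' F' → P2Objective Z X F ≤ P2Objective Z X' F'

/-- `P` solves the generalized algebraic Riccati equation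
`A'PA + C'PC + Q - (A'PB + C'PD)(R + B'PB + D'PD)⁻¹(B'PA + D'PC) = P`. -/
def SolvesGARE {n m : ℕ} (A : Matrix (Fin n) (Fin n) ℝ) (B : Matrix (Fin n) (Fin m) ℝ)
    (C : Matrix (Fin n) (Fin n) ℝ) (D : Matrix (Fin n) (Fin m) ℝ)
    (Q : Matrix (Fin n) (Fin n) ℝ) (R : Matrix (Fin m) (Fin m) ℝ)
    (P : Matrix (Fin n) (Fin n) ℝ) : Prop :=
  Aᵀ * P * A + Cᵀ * P * C + Q
    - (Aᵀ * P * B + Cᵀ * P * D) * (R + Bᵀ * P * B + Dᵀ * P * D)⁻¹ * (Bᵀ * P * A + Dᵀ * P * C)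
    = P

/-- The gain `-(R + B'PB + D'PD)⁻¹ (B'PA + D'PC)`. -/
noncomputable def riccatiGain {n m : ℕ} (A : Matrix (Fin n) (Fin n) ℝ)
    (B : Matrix (Fin n) (Fin m) ℝ) (C : Matrix (Fin n) (Fin n) ℝ) (D : Matrix (Fin n) (Fin m) ℝ)
    (R : Matrix (Fin m) (Fin m) ℝ) (P : Matrix (Fin n) (Fin n) ℝ) : Matrix (Fin m) (Fin n) ℝ :=
  -((R + Bᵀ * P * B + Dᵀ * P * D)⁻¹ * (Bᵀ * P * A + Dᵀ * P * C))

end SLQR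

/-! Because `w k` is centred with unit variance and independent of the state `x_k`, one has `E
x_k'Gx_k = z' L^k(G) z` with `L(G) = A'GA + C'GC`. The trace pairing moves `L` to its adjoint `lyap
Aᵀ Cᵀ`, which propagates the second moment matrices. Stability, observability, detectability and
cost are thereby expressed through positive semidefinite matrices under a linear map. For a
stabilizing `F` the total cost is `Tr(VZ)`, where `V = L_F(V) + Q + F'RF`.

Completing the square gives `L_F(P) + Q + F'RF = Ric(P) + (F-K)'W(F-K)`, with `K` the Riccati gain
and `W` the positive definite Riccati weight of `P` (`lyap_add_gainCost`). If `P` is a fixed point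
of `Ric`, then `V - P` solves the Lyapunov equation of `F` with the last term as source. Hence
`Tr(VZ) ≥ Tr(PZ) + Tr((F-K)'W(F-K)Z)`, and since `W` and `Z` are positive definite, equality of
costs forces `F = K`.

A fixed point `P` is the limit of the iterates of `Ric` from `0`, which increase and stay below the
value of any stabilizing gain (`exists_riccati_eq`). That `K` is stabilizing is the delicate point
(`momentStable_riccatiGain`). Its accumulated running cost is bounded by means of `P`. Were the
second moments not summable, normalized partial sums would accumulate at a matrix of trace one with
zero output whose trace never decreases along the flow, contradicting detectability.

Both matrix problems factor through `[I; F]`. In Problem II, `X` is determined by `V = [I; F]'X[I;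
F]`; in Problem I, `S = [I; F]Y[I; F]'`, where `Y` solves the adjoint Lyapunov equation with source
`Z`. Duality of the two equations identifies the objectives. -/

namespace SLQR

/-! ### Positive semidefinite matrices, the trace pairing and the Lyapunov operator. -/

section MatrixLemmas

lemma transpose_eq_of_posSemidef {ι : Type*} {G : Matrix ι ι ℝ} (hG : G.PosSemidef) : Gᵀ = G := by
  simpa using hG.isHermitian.eq

variable {ι κ : Type*} [Fintype ι] [Fintype κ]

lemma posSemidef_transpose_mul_mul {G : Matrix ι ι ℝ} (hG : G.PosSemidef) (A : Matrix ι κ ℝ) :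
    (Aᵀ * G * A).PosSemidef := by
  simpa using hG.conjTranspose_mul_mul_same A

lemma posSemidef_vecMulVec (z : ι → ℝ) : (Matrix.vecMulVec z z).PosSemidef := by
  simpa using Matrix.posSemidef_vecMulVec_self_star z

lemma trace_mul_vecMulVec (G : Matrix ι ι ℝ) (z : ι → ℝ) :
    (G * Matrix.vecMulVec z z).trace = z ⬝ᵥ G *ᵥ z := by
  rw [Matrix.mul_vecMulVec, Matrix.trace_vecMulVec, dotProduct_comm]

open scoped MatrixOrder in
lemma exists_transpose_mul_self {X : Matrix ι ι ℝ} (hX : X.PosSemidef) :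
    ∃ Y : Matrix ι ι ℝ, X = Yᵀ * Y := by
  classical
  obtain ⟨Y, hY⟩ := CStarAlgebra.nonneg_iff_eq_star_mul_self.1 hX.nonneg
  exact ⟨Y, by simpa [Matrix.star_eq_conjTranspose] using hY⟩

/-- A positive semidefinite matrix is a sum of dyads. -/
lemma exists_eq_sum_vecMulVec {X : Matrix ι ι ℝ} (hX : X.PosSemidef) :
    ∃ v : ι → ι → ℝ, X = ∑ i, Matrix.vecMulVec (v i) (v i) := by
  obtain ⟨Y, rfl⟩ := exists_transpose_mul_self hX
  refine ⟨Y, ?_⟩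
  ext i j
  simp [Matrix.mul_apply, Matrix.sum_apply, Matrix.vecMulVec_apply]

lemma trace_mul_nonneg {G X : Matrix ι ι ℝ} (hG : G.PosSemidef) (hX : X.PosSemidef) :
    0 ≤ (G * X).trace := by
  obtain ⟨v, rfl⟩ := exists_eq_sum_vecMulVec hX
  rw [Finset.mul_sum, Matrix.trace_sum]
  refine Finset.sum_nonneg fun i _ => ?_
  rw [trace_mul_vecMulVec]
  simpa using hG.dotProduct_mulVec_nonneg (v i)

lemma posSemidef_iff_real {G : Matrix ι ι ℝ} :
    G.PosSemidef ↔ Gᵀ = G ∧ ∀ z : ι → ℝ, 0 ≤ z ⬝ᵥ G *ᵥ z := by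
  rw [Matrix.posSemidef_iff_dotProduct_mulVec]
  simp [Matrix.IsHermitian]

lemma two_mul_abs_dotProduct_le (x y : ι → ℝ) :
    2 * |x ⬝ᵥ y| ≤ x ⬝ᵥ x + y ⬝ᵥ y := by
  have h1 : 0 ≤ (x - y) ⬝ᵥ (x - y) := by simpa using dotProduct_star_self_nonneg (x - y)
  have h2 : 0 ≤ (x + y) ⬝ᵥ (x + y) := by simpa using dotProduct_star_self_nonneg (x + y)
  simp only [sub_dotProduct, dotProduct_sub, add_dotProduct, dotProduct_add,
    dotProduct_comm y x] at h1 h2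
  rcases abs_cases (x ⬝ᵥ y) with h | h <;> linarith

/-- Writing `X = Y'Y`, each entry is an inner product of two columns of `Y`, at most half the sum of
two diagonal entries in absolute value. On the positive semidefinite cone the trace thus serves as a
norm. -/
lemma abs_apply_le_trace {X : Matrix ι ι ℝ} (hX : X.PosSemidef) (i j : ι) :
    |X i j| ≤ X.trace := by
  obtain ⟨Y, rfl⟩ := exists_transpose_mul_self hX
  have hd : ∀ i, 0 ≤ (Yᵀ * Y) i i := fun i => hX.diag_nonneg
  have hle : ∀ i, (Yᵀ * Y) i i ≤ (Yᵀ * Y).trace := fun i =>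
    Finset.single_le_sum (f := fun i => (Yᵀ * Y) i i) (fun i _ => hd i) (Finset.mem_univ i)
  have h := two_mul_abs_dotProduct_le (fun k => Y k i) (fun k => Y k j)
  have e : ∀ i j, (Yᵀ * Y) i j = (fun k => Y k i) ⬝ᵥ (fun k => Y k j) := fun i j => by
    simp [Matrix.mul_apply, dotProduct]
  rw [← e, ← e, ← e] at h
  linarith [hle i, hle j]

lemma eq_zero_of_trace_eq_zero {X : Matrix ι ι ℝ} (hX : X.PosSemidef) (h : X.trace = 0) :
    X = 0 := by
  ext i j
  simpa [h] using abs_apply_le_trace hX i j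

lemma eq_zero_of_posSemidef_neg {X : Matrix ι ι ℝ} (hX : X.PosSemidef) (h : (-X).PosSemidef) :
    X = 0 := by
  refine eq_zero_of_trace_eq_zero hX (le_antisymm ?_ hX.trace_nonneg)
  simpa using h.trace_nonneg

/-- If `W` is positive definite and `Tr (F'WF X) = 0`, then `F X = 0`. -/
lemma mul_eq_zero_of_trace_eq_zero {W : Matrix κ κ ℝ} (hW : W.PosDef) {X : Matrix ι ι ℝ}
    (hX : X.PosSemidef) (F : Matrix κ ι ℝ) (h : (Fᵀ * W * F * X).trace = 0) : F * X = 0 := by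
  obtain ⟨v, rfl⟩ := exists_eq_sum_vecMulVec hX
  rw [Finset.mul_sum, Matrix.trace_sum] at h
  have e : ∀ i, (Fᵀ * W * F * Matrix.vecMulVec (v i) (v i)).trace =
      (F *ᵥ v i) ⬝ᵥ W *ᵥ (F *ᵥ v i) := fun i => by
    rw [trace_mul_vecMulVec, ← Matrix.mulVec_mulVec, ← Matrix.mulVec_mulVec,
      Matrix.dotProduct_mulVec, Matrix.vecMul_transpose]
  have h0 := (Finset.sum_eq_zero_iff_of_nonneg fun i _ => by
    rw [e]; simpa using hW.posSemidef.dotProduct_mulVec_nonneg (F *ᵥ v i)).1 h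
  rw [Matrix.mul_sum]
  refine Finset.sum_eq_zero fun i hi => ?_
  have h1 := h0 i hi
  rw [e] at h1
  have h2 : F *ᵥ v i = 0 := by
    by_contra hne
    have := hW.dotProduct_mulVec_pos hne
    simp only [star_trivial] at this
    linarith
  rw [Matrix.mul_vecMulVec, h2]
  simp

/-- The Lyapunov operator `G ↦ A'GA + C'GC`. -/
def lyap (A C : Matrix ι ι ℝ) : Module.End ℝ (Matrix ι ι ℝ) where
  toFun G := Aᵀ * G * A + Cᵀ * G * C
  map_add' G H := by simp only [mul_add, add_mul]; abel
  map_smul' c G := by simp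

lemma lyap_apply (A C G : Matrix ι ι ℝ) : lyap A C G = Aᵀ * G * A + Cᵀ * G * C := rfl

lemma lyap_pow_succ (A C G : Matrix ι ι ℝ) (k : ℕ) :
    (lyap A C ^ (k + 1)) G = (lyap A C ^ k) (lyap A C G) := by
  rw [pow_succ]; rfl

lemma lyap_pow_succ' (A C G : Matrix ι ι ℝ) (k : ℕ) :
    (lyap A C ^ (k + 1)) G = lyap A C ((lyap A C ^ k) G) := by
  rw [pow_succ']; rfl

lemma lyap_posSemidef (A C : Matrix ι ι ℝ) {G : Matrix ι ι ℝ} (hG : G.PosSemidef) :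
    (lyap A C G).PosSemidef :=
  (posSemidef_transpose_mul_mul hG A).add (posSemidef_transpose_mul_mul hG C)

lemma lyap_pow_posSemidef (A C : Matrix ι ι ℝ) {G : Matrix ι ι ℝ} (hG : G.PosSemidef) (k : ℕ) :
    ((lyap A C ^ k) G).PosSemidef := by
  induction k with
  | zero => simpa using hG
  | succ k ih => rw [lyap_pow_succ']; exact lyap_posSemidef A C ih

/-- Cyclicity of the trace: transposing the coefficients gives the adjoint operator, the one that
propagates second moments. -/
lemma trace_mul_lyap (A C G X : Matrix ι ι ℝ) :
    (G * lyap Aᵀ Cᵀ X).trace = (lyap A C G * X).trace := by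
  simp only [lyap_apply, Matrix.transpose_transpose, mul_add, add_mul, Matrix.trace_add]
  congr 1
  · rw [← mul_assoc, Matrix.trace_mul_comm]; simp only [mul_assoc]
  · rw [← mul_assoc, Matrix.trace_mul_comm]; simp only [mul_assoc]

lemma trace_mul_lyap_pow (A C G X : Matrix ι ι ℝ) (k : ℕ) :
    (G * (lyap Aᵀ Cᵀ ^ k) X).trace = ((lyap A C ^ k) G * X).trace := by
  induction k generalizing G with
  | zero => simp
  | succ k ih => rw [lyap_pow_succ', trace_mul_lyap, ih, ← lyap_pow_succ]

end MatrixLemmas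

/-! ### From trajectories to second moments. -/

section Moments

lemma measurable_mulVec {Ω : Type*} [MeasurableSpace Ω] {n m : ℕ} (A : Matrix (Fin m) (Fin n) ℝ) {x : Ω → Fin n → ℝ}
    (hx : Measurable x) : Measurable fun ω => A *ᵥ x ω := by
  refine measurable_pi_lambda _ fun i => ?_
  simp only [Matrix.mulVec, dotProduct]
  fun_prop

/-- `x_k` is a measurable function of `w_0, …, w_{k-1}`. -/
lemma exists_traj_eq {Ω : Type*} {n : ℕ} (w : ℕ → Ω → ℝ) (A C : Matrix (Fin n) (Fin n) ℝ) (z : Fin n → ℝ) (k : ℕ) :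
    ∃ f : (Finset.range k → ℝ) → Fin n → ℝ, Measurable f ∧
      traj w A C z k = fun ω => f fun i => w i ω := by
  induction k with
  | zero => exact ⟨fun _ => z, measurable_const, rfl⟩
  | succ k ih =>
    obtain ⟨f, hf, h⟩ := ih
    let g : (Finset.range (k + 1) → ℝ) → (Finset.range k → ℝ) := fun u i =>
      u ⟨i, Finset.mem_range.2 ((Finset.mem_range.1 i.2).trans k.lt_succ_self)⟩
    have hg : Measurable g := measurable_pi_lambda _ fun i => measurable_pi_apply _
    refine ⟨fun u => A *ᵥ f (g u) + u ⟨k, Finset.self_mem_range_succ k⟩ • (C *ᵥ f (g u)),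
      (measurable_mulVec A (hf.comp hg)).add
        ((measurable_pi_apply _).smul (measurable_mulVec C (hf.comp hg))), ?_⟩
    ext1 ω
    simp only [traj, h]
    rfl

variable {Ω : Type*} [MeasurableSpace Ω] {μ : Measure Ω} {n : ℕ} {w : ℕ → Ω → ℝ}

lemma measurable_traj (hw : ∀ k, Measurable (w k)) (A C : Matrix (Fin n) (Fin n) ℝ)
    (z : Fin n → ℝ) (k : ℕ) : Measurable (traj w A C z k) := by
  induction k with
  | zero => exact measurable_const
  | succ k ih =>
    exact (measurable_mulVec A ih).add ((hw k).smul (measurable_mulVec C ih))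

/-- The state at time `k` involves only the noise strictly before `k`. -/
lemma indepFun_traj_noise [IsProbabilityMeasure μ] (hw : IsUnitWhiteNoise μ w)
    (A C : Matrix (Fin n) (Fin n) ℝ) (z : Fin n → ℝ) (k : ℕ) :
    IndepFun (traj w A C z k) (w k) μ := by
  obtain ⟨f, hf, h⟩ := exists_traj_eq w A C z k
  have hd : Disjoint (Finset.range k) {k} := by simp
  have hi := hw.indep.indepFun_finset (Finset.range k) {k} hd hw.measurable
  rw [h]
  exact hi.comp hf (measurable_pi_apply (⟨k, by simp⟩ : ({k} : Finset ℕ)))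

lemma quadratic_step {ι : Type*} [Fintype ι] (A C G : Matrix ι ι ℝ) (x : ι → ℝ) (s : ℝ) :
    (A *ᵥ x + s • (C *ᵥ x)) ⬝ᵥ G *ᵥ (A *ᵥ x + s • (C *ᵥ x)) =
      x ⬝ᵥ (Aᵀ * G * A) *ᵥ x + (x ⬝ᵥ (Aᵀ * G * C + Cᵀ * G * A) *ᵥ x) * s +
        (x ⬝ᵥ (Cᵀ * G * C) *ᵥ x) * (s * s) := by
  have e : ∀ U V : Matrix ι ι ℝ, x ⬝ᵥ (Uᵀ * G * V) *ᵥ x = (U *ᵥ x) ⬝ᵥ G *ᵥ (V *ᵥ x) := by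
    intro U V
    rw [← Matrix.mulVec_mulVec, ← Matrix.mulVec_mulVec, Matrix.dotProduct_mulVec,
      Matrix.vecMul_transpose]
  rw [Matrix.add_mulVec, dotProduct_add, e, e, e, e]
  simp only [Matrix.mulVec_add, Matrix.mulVec_smul, add_dotProduct, dotProduct_add,
    smul_dotProduct, dotProduct_smul, smul_eq_mul]
  ring

lemma measurable_quadratic (G : Matrix (Fin n) (Fin n) ℝ) :
    Measurable fun x : Fin n → ℝ => x ⬝ᵥ G *ᵥ x := by
  simp only [Matrix.mulVec, dotProduct]
  fun_prop

/-- Second moments of the state propagate by the Lyapunov operator. -/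
lemma integral_quadratic_traj [IsProbabilityMeasure μ] (hw : IsUnitWhiteNoise μ w)
    (A C : Matrix (Fin n) (Fin n) ℝ) (z : Fin n → ℝ) (k : ℕ) (G : Matrix (Fin n) (Fin n) ℝ) :
    Integrable (fun ω => traj w A C z k ω ⬝ᵥ G *ᵥ traj w A C z k ω) μ ∧
      ∫ ω, traj w A C z k ω ⬝ᵥ G *ᵥ traj w A C z k ω ∂μ = z ⬝ᵥ ((lyap A C ^ k) G) *ᵥ z := by
  induction k generalizing G with
  | zero => simp [traj]
  | succ k ih =>
    have hind := indepFun_traj_noise hw A C z k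
    have hi1 : IndepFun (fun ω => traj w A C z k ω ⬝ᵥ
        (Aᵀ * G * C + Cᵀ * G * A) *ᵥ traj w A C z k ω) (w k) μ :=
      hind.comp (measurable_quadratic _) measurable_id
    have hi2 : IndepFun (fun ω => traj w A C z k ω ⬝ᵥ
        (Cᵀ * G * C) *ᵥ traj w A C z k ω) (fun ω => w k ω * w k ω) μ :=
      hind.comp (measurable_quadratic _) (measurable_id.mul measurable_id)
    have hw1 : Integrable (w k) μ := (hw.memLp k).integrable one_le_two
    have hw2 : Integrable (fun ω => w k ω * w k ω) μ := by
      simpa [sq] using (hw.memLp k).integrable_sq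
    have h1 := hi1.integrable_mul (ih _).1 hw1
    have h2 := hi2.integrable_mul (ih _).1 hw2
    have e1 := hi1.integral_fun_mul_eq_mul_integral (ih _).1.aestronglyMeasurable
      hw1.aestronglyMeasurable
    have e2 := hi2.integral_fun_mul_eq_mul_integral (ih _).1.aestronglyMeasurable
      hw2.aestronglyMeasurable
    -- The cross term carries the factor `E w_k = 0` and the quadratic one `E w_k² = 1`, so exactly
    -- the two terms of `lyap` survive.
    rw [hw.mean, mul_zero] at e1
    rw [hw.cov, if_pos rfl, mul_one] at e2
    simp only [traj, quadratic_step]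
    have h3 := ((ih (Aᵀ * G * A)).1.add h1)
    refine ⟨h3.add h2, ?_⟩
    have e3 := integral_add h3 h2
    have e4 := integral_add (ih (Aᵀ * G * A)).1 h1
    simp only [Pi.add_apply, Pi.mul_apply] at e3 e4
    rw [e3, e4, e1, e2, (ih _).2, (ih _).2, lyap_pow_succ, lyap_apply, map_add,
      Matrix.add_mulVec, dotProduct_add, add_zero]

/-- The expectation of a nonnegative quadratic form of the state. -/
lemma lintegral_quadratic_traj [IsProbabilityMeasure μ] (hw : IsUnitWhiteNoise μ w)
    (A C : Matrix (Fin n) (Fin n) ℝ) (z : Fin n → ℝ) (k : ℕ) {G : Matrix (Fin n) (Fin n) ℝ}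
    (hG : G.PosSemidef) :
    ∫⁻ ω, ENNReal.ofReal (traj w A C z k ω ⬝ᵥ G *ᵥ traj w A C z k ω) ∂μ =
      ENNReal.ofReal (G * (lyap Aᵀ Cᵀ ^ k) (Matrix.vecMulVec z z)).trace := by
  obtain ⟨hi, he⟩ := integral_quadratic_traj hw A C z k G
  rw [← ofReal_integral_eq_lintegral_ofReal hi
    (ae_of_all _ fun ω => (posSemidef_iff_real.1 hG).2 _), he, trace_mul_lyap_pow,
    trace_mul_vecMulVec]

lemma meanSquare_eq [IsProbabilityMeasure μ] (hw : IsUnitWhiteNoise μ w)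
    (A C : Matrix (Fin n) (Fin n) ℝ) (z : Fin n → ℝ) (k : ℕ) :
    meanSquare μ w A C z k =
      ENNReal.ofReal ((lyap Aᵀ Cᵀ ^ k) (Matrix.vecMulVec z z)).trace := by
  simpa [meanSquare] using lintegral_quadratic_traj hw A C z k Matrix.PosSemidef.one

lemma tendsto_meanSquare_iff [IsProbabilityMeasure μ] (hw : IsUnitWhiteNoise μ w)
    (A C : Matrix (Fin n) (Fin n) ℝ) (z : Fin n → ℝ) :
    Tendsto (meanSquare μ w A C z) atTop (𝓝 0) ↔
      Tendsto (fun k => ((lyap Aᵀ Cᵀ ^ k) (Matrix.vecMulVec z z)).trace) atTop (𝓝 0) := by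
  have hnn := fun k =>
    (lyap_pow_posSemidef Aᵀ Cᵀ (posSemidef_vecMulVec z) k).trace_nonneg
  rw [show meanSquare μ w A C z = _ from funext (meanSquare_eq hw A C z)]
  constructor
  · intro h
    have := (ENNReal.tendsto_toReal ENNReal.zero_ne_top).comp h
    simpa [Function.comp_def, ENNReal.toReal_ofReal (hnn _)] using this
  · intro h
    simpa using ENNReal.tendsto_ofReal h

/-- Deterministic form of mean square stability: the second moment iterates vanish. -/
def MomentStable {ι : Type*} [Fintype ι] (A C : Matrix ι ι ℝ) : Prop :=
  ∀ X : Matrix ι ι ℝ, X.PosSemidef →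
    Tendsto (fun k => ((lyap Aᵀ Cᵀ ^ k) X).trace) atTop (𝓝 0)

/-- Initial vectors give dyads, and by linearity dyads suffice for all positive semidefinite
matrices. -/
lemma asms_iff_momentStable [IsProbabilityMeasure μ] (hw : IsUnitWhiteNoise μ w)
    (A C : Matrix (Fin n) (Fin n) ℝ) : ASMS μ w A C ↔ MomentStable A C := by
  simp only [ASMS, tendsto_meanSquare_iff hw]
  refine ⟨fun h X hX => ?_, fun h z => h _ (posSemidef_vecMulVec z)⟩
  obtain ⟨v, rfl⟩ := exists_eq_sum_vecMulVec hX
  simp only [map_sum, Matrix.trace_sum]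
  simpa using tendsto_finsetSum Finset.univ fun i _ => h (v i)

/-- Vanishing outputs in terms of second moments. -/
lemma ae_mulVec_traj_eq_zero [IsProbabilityMeasure μ] (hw : IsUnitWhiteNoise μ w)
    (A C : Matrix (Fin n) (Fin n) ℝ) (z : Fin n → ℝ) (k : ℕ) {Q : Matrix (Fin n) (Fin n) ℝ}
    (hQ : Q.PosSemidef) (h : (Q * (lyap Aᵀ Cᵀ ^ k) (Matrix.vecMulVec z z)).trace = 0) :
    ∀ᵐ ω ∂μ, Q *ᵥ traj w A C z k ω = 0 := by
  have e := lintegral_quadratic_traj hw A C z k hQ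
  rw [h, ENNReal.ofReal_zero, lintegral_eq_zero_iff] at e
  · filter_upwards [e] with ω hω
    have h0 : 0 ≤ traj w A C z k ω ⬝ᵥ Q *ᵥ traj w A C z k ω := (posSemidef_iff_real.1 hQ).2 _
    have h1 := le_antisymm (ENNReal.ofReal_eq_zero.1 hω) h0
    exact (hQ.dotProduct_mulVec_zero_iff _).1 (by simpa using h1)
  · exact ENNReal.measurable_ofReal.comp
      ((measurable_quadratic Q).comp (measurable_traj hw.measurable A C z k))

/-- Exact observability and exact detectability in terms of second moments. -/
lemma tendsto_of_output_eq_zero [IsProbabilityMeasure μ] (hw : IsUnitWhiteNoise μ w)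
    {A C Q : Matrix (Fin n) (Fin n) ℝ} (hQ : Q.PosSemidef)
    (hobs : ExactlyObservable μ w A C Q ∨ ExactlyDetectable μ w A C Q)
    {X : Matrix (Fin n) (Fin n) ℝ} (hX : X.PosSemidef)
    (h : ∀ k, (Q * (lyap Aᵀ Cᵀ ^ k) X).trace = 0) :
    Tendsto (fun k => ((lyap Aᵀ Cᵀ ^ k) X).trace) atTop (𝓝 0) := by
  obtain ⟨v, rfl⟩ := exists_eq_sum_vecMulVec hX
  -- The outputs of the dyads are nonnegative and sum to zero, so each vanishes; the hypotheses on
  -- trajectories then apply to each vector `v i`.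
  have h0 : ∀ i k, (Q * (lyap Aᵀ Cᵀ ^ k) (Matrix.vecMulVec (v i) (v i))).trace = 0 := by
    intro i k
    have hk := h k
    rw [map_sum, Matrix.mul_sum, Matrix.trace_sum] at hk
    exact (Finset.sum_eq_zero_iff_of_nonneg fun i _ => trace_mul_nonneg hQ
      (lyap_pow_posSemidef _ _ (posSemidef_vecMulVec _) k)).1 hk i (Finset.mem_univ i)
  simp only [map_sum, Matrix.trace_sum]
  rw [show (0 : ℝ) = ∑ i : Fin n, 0 by simp]
  refine tendsto_finsetSum Finset.univ fun i _ => ?_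
  have hae := fun k => ae_mulVec_traj_eq_zero hw A C (v i) k hQ (h0 i k)
  rcases hobs with ⟨T, -, hT⟩ | ⟨T, -, hT⟩
  · simp [hT (v i) fun k _ => hae k]
  · exact (tendsto_meanSquare_iff hw A C (v i)).1 (hT (v i) fun k _ => hae k)

end Moments

/-! ### Mean square stability and Lyapunov equations. -/

section Stability

variable {ι : Type*} [Fintype ι]

lemma isClosed_posSemidef : IsClosed {X : Matrix ι ι ℝ | X.PosSemidef} := by
  simp only [posSemidef_iff_real, Set.ofPred_and, Set.ofPred_forall]
  refine (isClosed_eq (by fun_prop) (by fun_prop)).inter (isClosed_iInter fun z => ?_)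
  exact isClosed_le continuous_const (by fun_prop)

/-- A sequence of positive semidefinite matrices of trace at most one has a convergent subsequence. -/
lemma exists_subseq_tendsto {Y : ℕ → Matrix ι ι ℝ} (hY : ∀ k, (Y k).PosSemidef)
    (ht : ∀ k, (Y k).trace ≤ 1) :
    ∃ X : Matrix ι ι ℝ, ∃ φ : ℕ → ℕ, StrictMono φ ∧ Tendsto (Y ∘ φ) atTop (𝓝 X) := by
  have hc : IsCompact (Set.univ.pi fun _ => Set.univ.pi fun _ => Set.Icc (-1) 1 :
      Set (ι → ι → ℝ)) :=
    isCompact_univ_pi fun _ => isCompact_univ_pi fun _ => isCompact_Icc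
  let y : ℕ → ι → ι → ℝ := fun k i j => Y k i j
  have hy : ∀ k, y k ∈ (Set.univ.pi fun _ => Set.univ.pi fun _ => Set.Icc (-1) 1 :
      Set (ι → ι → ℝ)) := fun k i _ j _ =>
    abs_le.1 ((abs_apply_le_trace (hY k) i j).trans (ht k))
  obtain ⟨X, -, φ, hφ, h⟩ := hc.tendsto_subseq hy
  exact ⟨X, φ, hφ, h⟩

lemma continuous_lyap (A C : Matrix ι ι ℝ) : Continuous (lyap A C) := by
  change Continuous fun G => Aᵀ * G * A + Cᵀ * G * C
  fun_prop

lemma continuous_lyap_pow (A C : Matrix ι ι ℝ) (k : ℕ) : Continuous ⇑(lyap A C ^ k) := by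
  induction k with
  | zero => exact continuous_id
  | succ k ih => rw [pow_succ]; exact ih.comp (continuous_lyap A C)

/-- If the second moments are not summable although the output energy is finite, then some
nonzero second moment matrix with zero output does not decrease. -/
lemma exists_nondecreasing_of_not_summable (A C : Matrix ι ι ℝ) {M X₀ : Matrix ι ι ℝ}
    (hM : M.PosSemidef) (hX₀ : X₀.PosSemidef) {K : ℝ}
    (hK : ∀ N, ∑ k ∈ Finset.range N, (M * (lyap A C ^ k) X₀).trace ≤ K)
    (hns : ¬ Summable fun k => ((lyap A C ^ k) X₀).trace) :
    ∃ X : Matrix ι ι ℝ, X.PosSemidef ∧ X.trace = 1 ∧ (lyap A C X - X).PosSemidef ∧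
      ∀ j, (M * (lyap A C ^ j) X).trace = 0 := by
  set L := lyap A C with hL
  have hpos : ∀ k, ((L ^ k) X₀).PosSemidef := lyap_pow_posSemidef A C hX₀
  let S : ℕ → Matrix ι ι ℝ := fun N => ∑ k ∈ Finset.range N, (L ^ k) X₀
  have hS : ∀ N, (S N).PosSemidef := fun N => Matrix.posSemidef_sum _ fun k _ => hpos k
  have htr : ∀ N, (S N).trace = ∑ k ∈ Finset.range N, ((L ^ k) X₀).trace := fun N =>
    Matrix.trace_sum _ _
  have htop : Tendsto (fun N => (S N).trace) atTop atTop := by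
    simp only [htr]
    exact (not_summable_iff_tendsto_nat_atTop_of_nonneg fun k => (hpos k).trace_nonneg).1 hns
  -- Both sides are the sum of the first `N + 1` iterates. After division by the diverging trace,
  -- the `X₀` term vanishes and `L X - X` becomes a limit of positive semidefinite matrices.
  have hLS : ∀ N, L (S N) + X₀ = S N + (L ^ N) X₀ := by
    intro N
    have h1 := Finset.sum_range_succ (fun k => (L ^ k) X₀) N
    rw [Finset.sum_range_succ'] at h1
    rw [← h1, pow_zero, Module.End.one_apply, map_sum]
    congr 1
    exact Finset.sum_congr rfl fun k _ => (lyap_pow_succ' A C X₀ k).symm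
  -- Shifting by `j` only drops nonnegative terms from the energy up to time `j + N`. The bound is
  -- uniform in `N`, so normalization sends the output to zero.
  have hMS : ∀ j N, (M * (L ^ j) (S N)).trace ≤ K := by
    intro j N
    refine le_trans ?_ (hK (j + N))
    rw [Finset.sum_range_add, map_sum, Matrix.mul_sum, Matrix.trace_sum]
    simp only [pow_add, Module.End.mul_apply]
    exact le_add_of_nonneg_left (Finset.sum_nonneg fun k _ => trace_mul_nonneg hM (hpos k))
  let Y : ℕ → Matrix ι ι ℝ := fun N => (S N).trace⁻¹ • S N
  have hinv : ∀ N, 0 ≤ (S N).trace⁻¹ := fun N => inv_nonneg.2 (hS N).trace_nonneg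
  have hY : ∀ N, (Y N).PosSemidef := fun N => (hS N).smul (hinv N)
  have hYt : ∀ N, (Y N).trace = (S N).trace⁻¹ * (S N).trace := fun N => by
    simp [Y, Matrix.trace_smul]
  obtain ⟨X, φ, hφ, hlim⟩ := exists_subseq_tendsto hY fun N => by
    rw [hYt]; exact inv_mul_le_one
  have htop' := htop.comp hφ.tendsto_atTop
  have hinv0 : Tendsto (fun N => (S (φ N)).trace⁻¹) atTop (𝓝 0) := htop'.inv_tendsto_atTop
  refine ⟨X, isClosed_posSemidef.mem_of_tendsto hlim (Eventually.of_forall fun k => hY _), ?_,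
    ?_, fun j => ?_⟩
  · refine tendsto_nhds_unique
      ((continuous_id.matrix_trace.tendsto X).comp hlim) (tendsto_const_nhds.congr' ?_)
    -- Where the trace of the partial sum is zero, its inverse is `0` by convention; the
    -- normalization to trace one holds only eventually.
    filter_upwards [htop'.eventually_gt_atTop 0] with N hN
    simp only [Function.comp_apply, id] at hN ⊢
    rw [hYt, inv_mul_cancel₀ hN.ne']
  · have h1 : Tendsto (fun N => L (Y (φ N)) - Y (φ N) + (S (φ N)).trace⁻¹ • X₀) atTop
        (𝓝 (L X - X + (0 : ℝ) • X₀)) :=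
      ((((continuous_lyap A C).tendsto X).comp hlim).sub hlim).add (hinv0.smul_const X₀)
    rw [zero_smul, add_zero] at h1
    refine isClosed_posSemidef.mem_of_tendsto h1 (Eventually.of_forall fun N => ?_)
    have : L (Y (φ N)) - Y (φ N) + (S (φ N)).trace⁻¹ • X₀ =
        (S (φ N)).trace⁻¹ • (L ^ φ N) X₀ := by
      rw [map_smul, ← smul_sub, ← smul_add]
      congr 1
      rw [sub_add_eq_add_sub, hLS, add_sub_cancel_left]
    rw [Set.mem_ofPred_eq, this]
    exact (hpos _).smul (hinv _)
  · have hc : Continuous fun G => (M * (L ^ j) G).trace :=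
      (continuous_const.matrix_mul (continuous_lyap_pow A C j)).matrix_trace
    have h1 := (hc.tendsto X).comp hlim
    have hXp : X.PosSemidef :=
      isClosed_posSemidef.mem_of_tendsto hlim (Eventually.of_forall fun k => hY _)
    refine le_antisymm ?_ (trace_mul_nonneg hM (lyap_pow_posSemidef A C hXp j))
    refine le_of_tendsto_of_tendsto' h1 (by simpa using hinv0.mul_const K) fun N => ?_
    simp only [Function.comp_apply, Y, map_smul, Matrix.mul_smul, Matrix.trace_smul, smul_eq_mul]
    exact mul_le_mul_of_nonneg_left (hMS j _) (hinv _)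

lemma trace_le_trace_lyap_pow (A C : Matrix ι ι ℝ) {X : Matrix ι ι ℝ}
    (h : (lyap A C X - X).PosSemidef) (k : ℕ) : X.trace ≤ ((lyap A C ^ k) X).trace := by
  induction k with
  | zero => simp
  | succ k ih =>
    refine ih.trans ?_
    have := (lyap_pow_posSemidef A C h k).trace_nonneg
    rw [map_sub, Matrix.trace_sub, ← lyap_pow_succ] at this
    linarith

/-- Second moments with finite output energy are summable if zero output forces decay. -/
lemma summable_trace_of_detectable (A C : Matrix ι ι ℝ) {M X₀ : Matrix ι ι ℝ}
    (hM : M.PosSemidef) (hX₀ : X₀.PosSemidef) {K : ℝ}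
    (hK : ∀ N, ∑ k ∈ Finset.range N, (M * (lyap A C ^ k) X₀).trace ≤ K)
    (hdet : ∀ X : Matrix ι ι ℝ, X.PosSemidef → (∀ j, (M * (lyap A C ^ j) X).trace = 0) →
      Tendsto (fun k => ((lyap A C ^ k) X).trace) atTop (𝓝 0)) :
    Summable fun k => ((lyap A C ^ k) X₀).trace := by
  by_contra hns
  obtain ⟨X, hX, h1, hle, h0⟩ := exists_nondecreasing_of_not_summable A C hM hX₀ hK hns
  have := ge_of_tendsto' (hdet X hX h0) (trace_le_trace_lyap_pow A C hle)
  linarith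

/-- The case `M = 0` of the detectability argument: every output is zero, so mere convergence to
zero upgrades to summability. -/
lemma MomentStable.summable_trace {A C : Matrix ι ι ℝ} (h : MomentStable A C)
    {X : Matrix ι ι ℝ} (hX : X.PosSemidef) :
    Summable fun k => ((lyap Aᵀ Cᵀ ^ k) X).trace :=
  summable_trace_of_detectable Aᵀ Cᵀ (M := 0) Matrix.PosSemidef.zero hX (K := 0) (by simp)
    fun X hX _ => h X hX

/-- By duality the trace of `L^k` of a dyad pairs that dyad with the adjoint iterate of the
identity, whose entries are dominated by its trace. This transfers solvability from the dual
Lyapunov equation to the primal one. -/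
lemma MomentStable.transpose {A C : Matrix ι ι ℝ} (h : MomentStable A C) :
    MomentStable Aᵀ Cᵀ := by
  classical
  intro X hX
  obtain ⟨v, rfl⟩ := exists_eq_sum_vecMulVec hX
  simp only [Matrix.transpose_transpose, map_sum, Matrix.trace_sum]
  rw [show (0 : ℝ) = ∑ i : ι, 0 by simp]
  refine tendsto_finsetSum Finset.univ fun i _ => ?_
  set V := Matrix.vecMulVec (v i) (v i)
  have e : ∀ k, ((lyap A C ^ k) V).trace = (V * (lyap Aᵀ Cᵀ ^ k) 1).trace := fun k => by
    rw [trace_mul_lyap_pow, mul_one]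
  simp only [e]
  have hent : ∀ a b, Tendsto (fun k => (lyap Aᵀ Cᵀ ^ k) 1 a b) atTop (𝓝 0) := fun a b =>
    squeeze_zero_norm (fun k => abs_apply_le_trace
      (lyap_pow_posSemidef Aᵀ Cᵀ Matrix.PosSemidef.one k) a b) (h 1 Matrix.PosSemidef.one)
  simp only [Matrix.trace, Matrix.diag, Matrix.mul_apply]
  rw [show (0 : ℝ) = ∑ a : ι, ∑ b : ι, V a b * 0 by simp]
  exact tendsto_finsetSum _ fun a _ => tendsto_finsetSum _ fun b _ => (hent b a).const_mul _

lemma abs_trace_mul_le (G : Matrix ι ι ℝ) {X : Matrix ι ι ℝ} (hX : X.PosSemidef) :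
    |(G * X).trace| ≤ (∑ a, ∑ b, |G a b|) * X.trace := by
  simp only [Matrix.trace, Matrix.diag, Matrix.mul_apply]
  refine (Finset.abs_sum_le_sum_abs _ _).trans ?_
  rw [Finset.sum_mul]
  refine Finset.sum_le_sum fun a _ => (Finset.abs_sum_le_sum_abs _ _).trans ?_
  rw [Finset.sum_mul]
  refine Finset.sum_le_sum fun b _ => ?_
  rw [abs_mul]
  exact mul_le_mul_of_nonneg_left (abs_apply_le_trace hX b a) (abs_nonneg _)

/-- The sum telescopes: pairing the equation with the `k`th iterate expresses the output as a
decrease of `Tr(G ·)`. Neither stability nor definiteness enters. -/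
lemma sum_trace_eq_of_lyap_eq {A C G M : Matrix ι ι ℝ} (hG : G = lyap A C G + M)
    (X : Matrix ι ι ℝ) (N : ℕ) :
    ∑ k ∈ Finset.range N, (M * (lyap Aᵀ Cᵀ ^ k) X).trace =
      (G * X).trace - (G * (lyap Aᵀ Cᵀ ^ N) X).trace := by
  induction N with
  | zero => simp
  | succ N ih =>
    have h1 := congrArg (fun H => (H * (lyap Aᵀ Cᵀ ^ N) X).trace) hG
    simp only [add_mul, Matrix.trace_add] at h1
    rw [Finset.sum_range_succ, ih, lyap_pow_succ', trace_mul_lyap]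
    linarith

lemma MomentStable.summable_trace_mul {A C : Matrix ι ι ℝ} (h : MomentStable A C)
    (G : Matrix ι ι ℝ) {X : Matrix ι ι ℝ} (hX : X.PosSemidef) :
    Summable fun k => (G * (lyap Aᵀ Cᵀ ^ k) X).trace :=
  Summable.of_norm_bounded ((h.summable_trace hX).mul_left _)
    fun k => abs_trace_mul_le G (lyap_pow_posSemidef Aᵀ Cᵀ hX k)

/-- Solutions of the Lyapunov equation represent the accumulated cost. -/
lemma MomentStable.hasSum_trace_mul {A C : Matrix ι ι ℝ} (h : MomentStable A C)
    {G M : Matrix ι ι ℝ} (hG : G = lyap A C G + M) {X : Matrix ι ι ℝ} (hX : X.PosSemidef) :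
    HasSum (fun k => (M * (lyap Aᵀ Cᵀ ^ k) X).trace) (G * X).trace := by
  refine (h.summable_trace_mul M hX).hasSum_iff_tendsto_nat.2 ?_
  simp only [sum_trace_eq_of_lyap_eq hG]
  simpa using tendsto_const_nhds.sub (h.summable_trace_mul G hX).tendsto_atTop_zero

/-- The Lyapunov equation has positive solutions only, if its source is positive. -/
lemma MomentStable.posSemidef_of_lyap_eq {A C : Matrix ι ι ℝ} (h : MomentStable A C)
    {G M : Matrix ι ι ℝ} (hGs : Gᵀ = G) (hG : G = lyap A C G + M) (hM : M.PosSemidef) :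
    G.PosSemidef := by
  refine posSemidef_iff_real.2 ⟨hGs, fun z => ?_⟩
  rw [← trace_mul_vecMulVec]
  exact (h.hasSum_trace_mul hG (posSemidef_vecMulVec z)).nonneg fun k =>
    trace_mul_nonneg hM (lyap_pow_posSemidef Aᵀ Cᵀ (posSemidef_vecMulVec z) k)

/-- The dual Lyapunov equation is solvable. -/
lemma MomentStable.exists_dual_lyap_eq {A C : Matrix ι ι ℝ} (h : MomentStable A C)
    {Z : Matrix ι ι ℝ} (hZ : Z.PosSemidef) :
    ∃ Y : Matrix ι ι ℝ, Y.PosSemidef ∧ Y = lyap Aᵀ Cᵀ Y + Z := by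
  set L := lyap Aᵀ Cᵀ
  have hpos : ∀ k, ((L ^ k) Z).PosSemidef := lyap_pow_posSemidef Aᵀ Cᵀ hZ
  -- The solution is the Neumann series, summable entrywise by comparison with the traces.
  have hs : Summable fun k => (L ^ k) Z := by
    refine Pi.summable.2 fun a => Pi.summable.2 fun b => ?_
    exact Summable.of_norm_bounded (h.summable_trace hZ) fun k => abs_apply_le_trace (hpos k) a b
  refine ⟨∑' k, (L ^ k) Z, ?_, ?_⟩
  · exact isClosed_posSemidef.mem_of_tendsto hs.hasSum.tendsto_sum_nat
      (Eventually.of_forall fun N => Matrix.posSemidef_sum _ fun k _ => hpos k)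
  · have h1 := hs.map_tsum L (continuous_lyap Aᵀ Cᵀ)
    have h2 := hs.tsum_eq_zero_add
    rw [h1]
    conv_lhs => rw [h2]
    rw [add_comm, pow_zero, Module.End.one_apply]
    congr 1
    exact tsum_congr fun k => lyap_pow_succ' Aᵀ Cᵀ Z k

lemma MomentStable.exists_lyap_eq {A C : Matrix ι ι ℝ} (h : MomentStable A C)
    {M : Matrix ι ι ℝ} (hM : M.PosSemidef) :
    ∃ P : Matrix ι ι ℝ, P.PosSemidef ∧ P = lyap A C P + M := by
  simpa using h.transpose.exists_dual_lyap_eq hM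

/-- The Lyapunov criterion: a positive semidefinite solution forces stability if zero output
forces decay. -/
lemma momentStable_of_lyap_eq {A C P M : Matrix ι ι ℝ} (hP : P.PosSemidef) (hM : M.PosSemidef)
    (h : P = lyap A C P + M)
    (hdet : ∀ X : Matrix ι ι ℝ, X.PosSemidef → (∀ j, (M * (lyap Aᵀ Cᵀ ^ j) X).trace = 0) →
      Tendsto (fun k => ((lyap Aᵀ Cᵀ ^ k) X).trace) atTop (𝓝 0)) :
    MomentStable A C := by
  intro X hX
  refine (summable_trace_of_detectable Aᵀ Cᵀ hM hX (K := (P * X).trace) (fun N => ?_)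
    hdet).tendsto_atTop_zero
  rw [sum_trace_eq_of_lyap_eq h]
  linarith [trace_mul_nonneg hP (lyap_pow_posSemidef Aᵀ Cᵀ hX N)]

end Stability

/-! ### The Riccati equation: existence, stabilization, uniqueness. -/

section Riccati

variable {n m : ℕ} (A : Matrix (Fin n) (Fin n) ℝ) (B : Matrix (Fin n) (Fin m) ℝ)
  (C : Matrix (Fin n) (Fin n) ℝ) (D : Matrix (Fin n) (Fin m) ℝ)
  (Q : Matrix (Fin n) (Fin n) ℝ) (R : Matrix (Fin m) (Fin m) ℝ)

/-- The weight `R + B'PB + D'PD` of the Riccati equation. -/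
def riccatiWeight (P : Matrix (Fin n) (Fin n) ℝ) : Matrix (Fin m) (Fin m) ℝ :=
  R + Bᵀ * P * B + Dᵀ * P * D

/-- The Riccati operator. -/
noncomputable def riccati (P : Matrix (Fin n) (Fin n) ℝ) : Matrix (Fin n) (Fin n) ℝ :=
  Aᵀ * P * A + Cᵀ * P * C + Q
    - (Aᵀ * P * B + Cᵀ * P * D) * (R + Bᵀ * P * B + Dᵀ * P * D)⁻¹ * (Bᵀ * P * A + Dᵀ * P * C)

/-- The closed-loop weight `Q + F'RF`. -/
def gainCost (F : Matrix (Fin m) (Fin n) ℝ) : Matrix (Fin n) (Fin n) ℝ := Q + Fᵀ * R * F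

/-- The excess `(F - K)' (R + B'PB + D'PD) (F - K)` of a gain `F` over the Riccati gain `K`. -/
noncomputable def gainExcess (P : Matrix (Fin n) (Fin n) ℝ) (F : Matrix (Fin m) (Fin n) ℝ) :
    Matrix (Fin n) (Fin n) ℝ :=
  (F - riccatiGain A B C D R P)ᵀ * riccatiWeight B D R P * (F - riccatiGain A B C D R P)

variable {A B C D Q R}

lemma posDef_riccatiWeight (hR : R.PosDef) {P : Matrix (Fin n) (Fin n) ℝ} (hP : P.PosSemidef) :
    (riccatiWeight B D R P).PosDef :=
  (hR.add_posSemidef (posSemidef_transpose_mul_mul hP B)).add_posSemidef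
    (posSemidef_transpose_mul_mul hP D)

lemma posSemidef_gainCost (hQ : Q.PosSemidef) (hR : R.PosDef) (F : Matrix (Fin m) (Fin n) ℝ) :
    (gainCost Q R F).PosSemidef :=
  hQ.add (posSemidef_transpose_mul_mul hR.posSemidef F)

lemma posSemidef_gainExcess (hR : R.PosDef) {P : Matrix (Fin n) (Fin n) ℝ} (hP : P.PosSemidef)
    (F : Matrix (Fin m) (Fin n) ℝ) : (gainExcess A B C D R P F).PosSemidef :=
  posSemidef_transpose_mul_mul (posDef_riccatiWeight hR hP).posSemidef _

lemma gainExcess_riccatiGain (P : Matrix (Fin n) (Fin n) ℝ) :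
    gainExcess A B C D R P (riccatiGain A B C D R P) = 0 := by
  simp [gainExcess]

lemma complete_square {W : Matrix (Fin m) (Fin m) ℝ} (hW : IsUnit W.det) (hWs : Wᵀ = W)
    (S F : Matrix (Fin m) (Fin n) ℝ) :
    (F - -(W⁻¹ * S))ᵀ * W * (F - -(W⁻¹ * S)) =
      Fᵀ * W * F + Fᵀ * S + Sᵀ * F + Sᵀ * W⁻¹ * S := by
  have hi : (W⁻¹)ᵀ = W⁻¹ := by rw [Matrix.transpose_nonsing_inv, hWs]
  have h1 : W * (W⁻¹ * S) = S := Matrix.mul_nonsing_inv_cancel_left W S hW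
  have h2 : ∀ Y : Matrix (Fin m) (Fin n) ℝ, W⁻¹ * (W * Y) = Y := fun Y =>
    Matrix.nonsing_inv_mul_cancel_left W Y hW
  simp only [sub_neg_eq_add, Matrix.transpose_add, Matrix.transpose_mul, hi, Matrix.add_mul,
    Matrix.mul_add, Matrix.mul_assoc, h1, h2]
  abel

/-- The left side is quadratic in `F` with leading coefficient the Riccati weight; completing the
square isolates its minimum `riccati`, attained at the Riccati gain. -/
lemma lyap_add_gainCost (hR : R.PosDef) {P : Matrix (Fin n) (Fin n) ℝ} (hP : P.PosSemidef)
    (F : Matrix (Fin m) (Fin n) ℝ) :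
    lyap (A + B * F) (C + D * F) P + gainCost Q R F =
      riccati A B C D Q R P + gainExcess A B C D R P F := by
  have hW := posDef_riccatiWeight (B := B) (D := D) hR hP
  have hs : (Bᵀ * P * A + Dᵀ * P * C)ᵀ = Aᵀ * P * B + Cᵀ * P * D := by
    simp [Matrix.transpose_mul, transpose_eq_of_posSemidef hP, Matrix.mul_assoc]
  have h := complete_square (hW.det_pos.ne'.isUnit)
    (transpose_eq_of_posSemidef hW.posSemidef) (Bᵀ * P * A + Dᵀ * P * C) F
  rw [gainExcess, riccatiGain]
  simp only [riccatiWeight] at h ⊢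
  rw [h, riccati, hs, lyap_apply, gainCost]
  simp only [Matrix.transpose_add, Matrix.transpose_mul, Matrix.add_mul, Matrix.mul_add,
    Matrix.mul_assoc]
  abel

lemma riccati_eq_lyap (hR : R.PosDef) {P : Matrix (Fin n) (Fin n) ℝ} (hP : P.PosSemidef) :
    riccati A B C D Q R P = lyap (A + B * riccatiGain A B C D R P)
      (C + D * riccatiGain A B C D R P) P + gainCost Q R (riccatiGain A B C D R P) := by
  rw [lyap_add_gainCost hR hP, gainExcess_riccatiGain, add_zero]

lemma posSemidef_riccati (hQ : Q.PosSemidef) (hR : R.PosDef) {P : Matrix (Fin n) (Fin n) ℝ}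
    (hP : P.PosSemidef) : (riccati A B C D Q R P).PosSemidef := by
  rw [riccati_eq_lyap hR hP]
  exact (lyap_posSemidef _ _ hP).add (posSemidef_gainCost hQ hR _)

/-- The Riccati operator lies below every closed-loop Lyapunov operator, monotonically. -/
lemma riccati_le_lyap (hR : R.PosDef) {P P' : Matrix (Fin n) (Fin n) ℝ} (hP : P.PosSemidef)
    (h : (P' - P).PosSemidef) (F : Matrix (Fin m) (Fin n) ℝ) :
    (lyap (A + B * F) (C + D * F) P' + gainCost Q R F
      - riccati A B C D Q R P).PosSemidef := by
  have e : lyap (A + B * F) (C + D * F) P' + gainCost Q R F - riccati A B C D Q R P =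
      lyap (A + B * F) (C + D * F) (P' - P) + gainExcess A B C D R P F := by
    rw [map_sub, ← sub_eq_iff_eq_add'.2 (lyap_add_gainCost hR hP F)]
    abel
  rw [e]
  exact (lyap_posSemidef _ _ h).add (posSemidef_gainExcess hR hP F)

/-- At `P'` the Riccati operator equals the closed-loop operator of its own gain, which dominates
the Riccati operator at `P`. -/
lemma riccati_mono (hR : R.PosDef) {P P' : Matrix (Fin n) (Fin n) ℝ} (hP : P.PosSemidef)
    (hP' : P'.PosSemidef) (h : (P' - P).PosSemidef) :
    (riccati A B C D Q R P' - riccati A B C D Q R P).PosSemidef := by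
  rw [riccati_eq_lyap hR hP']
  exact riccati_le_lyap hR hP h _

lemma continuousAt_riccati (hR : R.PosDef) {P : Matrix (Fin n) (Fin n) ℝ} (hP : P.PosSemidef) :
    ContinuousAt (riccati A B C D Q R) P := by
  have hW := posDef_riccatiWeight (B := B) (D := D) hR hP
  have hinv : ContinuousAt (fun P => (R + Bᵀ * P * B + Dᵀ * P * D)⁻¹) P := by
    have hc : Continuous fun P : Matrix (Fin n) (Fin n) ℝ => R + Bᵀ * P * B + Dᵀ * P * D := by
      fun_prop
    -- The inverse is the adjugate over the determinant, and positive definiteness keeps the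
    -- determinant away from zero.
    simp only [Matrix.inv_def, Ring.inverse_eq_inv']
    exact (hc.matrix_det.continuousAt.inv₀ hW.det_pos.ne').smul hc.matrix_adjugate.continuousAt
  have hmul : ∀ {a b c : ℕ} {f : Matrix (Fin n) (Fin n) ℝ → Matrix (Fin a) (Fin b) ℝ}
      {g : Matrix (Fin n) (Fin n) ℝ → Matrix (Fin b) (Fin c) ℝ},
      ContinuousAt f P → ContinuousAt g P → ContinuousAt (fun P => f P * g P) P := by
    intro a b c f g hf hg
    have hp : Continuous fun q : Matrix (Fin a) (Fin b) ℝ × Matrix (Fin b) (Fin c) ℝ =>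
        q.1 * q.2 := continuous_fst.matrix_mul continuous_snd
    exact hp.continuousAt.comp (hf.prodMk hg)
  have h1 : Continuous fun P : Matrix (Fin n) (Fin n) ℝ => Aᵀ * P * A + Cᵀ * P * C + Q := by
    fun_prop
  have h2 : Continuous fun P : Matrix (Fin n) (Fin n) ℝ => Aᵀ * P * B + Cᵀ * P * D := by
    fun_prop
  have h3 : Continuous fun P : Matrix (Fin n) (Fin n) ℝ => Bᵀ * P * A + Dᵀ * P * C := by
    fun_prop
  exact h1.continuousAt.sub (hmul (hmul h2.continuousAt hinv) h3.continuousAt)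

/-- Bounded nondecreasing sequences of symmetric matrices converge. -/
lemma exists_tendsto_of_mono {ι : Type*} [Fintype ι] {P : ℕ → Matrix ι ι ℝ} {U : Matrix ι ι ℝ}
    (hP : ∀ k, (P k)ᵀ = P k) (hmono : ∀ k, (P (k + 1) - P k).PosSemidef)
    (hU : ∀ k, (U - P k).PosSemidef) : ∃ X, Tendsto P atTop (𝓝 X) := by
  classical
  have hq : ∀ z : ι → ℝ, ∃ c, Tendsto (fun k => z ⬝ᵥ P k *ᵥ z) atTop (𝓝 c) := fun z => by
    refine ⟨_, tendsto_atTop_ciSup (monotone_nat_of_le_succ fun k => ?_)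
      ⟨z ⬝ᵥ U *ᵥ z, Set.forall_mem_range.2 fun k => ?_⟩⟩
    · have := (posSemidef_iff_real.1 (hmono k)).2 z
      rw [Matrix.sub_mulVec, dotProduct_sub] at this
      linarith
    · have := (posSemidef_iff_real.1 (hU k)).2 z
      rw [Matrix.sub_mulVec, dotProduct_sub] at this
      linarith
  choose c hc using hq
  let e : ι → ι → ℝ := fun i => Pi.single i 1
  -- Polarization recovers the entries from the limits of the quadratic forms.
  refine ⟨Matrix.of fun i j => (c (e i + e j) - c (e i - e j)) / 4, ?_⟩
  refine tendsto_pi_nhds.2 fun i => tendsto_pi_nhds.2 fun j => ?_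
  refine (((hc (e i + e j)).sub (hc (e i - e j))).div_const 4).congr fun k => ?_
  have hsym : P k j i = P k i j := congrFun (congrFun (hP k) i) j
  simp only [e, Matrix.mulVec_add, Matrix.mulVec_sub, add_dotProduct, sub_dotProduct,
    dotProduct_add, dotProduct_sub, Matrix.mulVec_single_one, single_one_dotProduct,
    Matrix.col_apply, hsym]
  ring

/-- Value iteration: the Riccati equation has a positive semidefinite solution. -/
lemma exists_riccati_eq (hQ : Q.PosSemidef) (hR : R.PosDef) {F : Matrix (Fin m) (Fin n) ℝ}
    (hF : MomentStable (A + B * F) (C + D * F)) :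
    ∃ P : Matrix (Fin n) (Fin n) ℝ, P.PosSemidef ∧ riccati A B C D Q R P = P := by
  obtain ⟨U, hU, hUe⟩ := hF.exists_lyap_eq (posSemidef_gainCost hQ hR F)
  let P : ℕ → Matrix (Fin n) (Fin n) ℝ := fun k => (riccati A B C D Q R)^[k] 0
  have hsucc : ∀ k, P (k + 1) = riccati A B C D Q R (P k) := fun k =>
    Function.iterate_succ_apply' _ _ _
  have hP : ∀ k, (P k).PosSemidef := fun k => by
    induction k with
    | zero => exact Matrix.PosSemidef.zero
    | succ k ih => rw [hsucc]; exact posSemidef_riccati hQ hR ih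
  have hmono : ∀ k, (P (k + 1) - P k).PosSemidef := fun k => by
    induction k with
    | zero => simpa [P] using hP 1
    | succ k ih =>
      have h := riccati_mono (A := A) (B := B) (C := C) (D := D) (Q := Q) hR (hP k) (hP (k + 1)) ih
      rwa [← hsucc, ← hsucc] at h
  -- `U` is fixed by the closed-loop operator of the stabilizing gain `F`, which lies above
  -- `riccati`.
  have hle : ∀ k, (U - P k).PosSemidef := fun k => by
    induction k with
    | zero => simpa [P] using hU
    | succ k ih =>
      rw [hsucc, hUe]
      exact riccati_le_lyap hR (hP k) ih F
  obtain ⟨X, hX⟩ := exists_tendsto_of_mono (fun k => transpose_eq_of_posSemidef (hP k)) hmono hle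
  have hXp : X.PosSemidef := isClosed_posSemidef.mem_of_tendsto hX (Eventually.of_forall hP)
  refine ⟨X, hXp, tendsto_nhds_unique ((continuousAt_riccati hR hXp).tendsto.comp hX) ?_⟩
  exact (hX.comp (tendsto_add_atTop_nat 1)).congr hsucc

/-- The condition on `(A, C | Q)` used in the Riccati theory: zero output forces decay. -/
def OutputDetectable (A C Q : Matrix (Fin n) (Fin n) ℝ) : Prop :=
  ∀ X : Matrix (Fin n) (Fin n) ℝ, X.PosSemidef →
    (∀ k, (Q * (lyap Aᵀ Cᵀ ^ k) X).trace = 0) →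
      Tendsto (fun k => ((lyap Aᵀ Cᵀ ^ k) X).trace) atTop (𝓝 0)

/-- Detectability is inherited by the closed loop with the output `Q + F'RF`. -/
lemma OutputDetectable.closedLoop (h : OutputDetectable A C Q) (hQ : Q.PosSemidef)
    (hR : R.PosDef) (F : Matrix (Fin m) (Fin n) ℝ) :
    OutputDetectable (A + B * F) (C + D * F) (gainCost Q R F) := by
  intro X hX h0
  have hpos := lyap_pow_posSemidef (A + B * F)ᵀ (C + D * F)ᵀ hX
  have hsplit : ∀ k, (Q * (lyap (A + B * F)ᵀ (C + D * F)ᵀ ^ k) X).trace = 0 ∧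
      F * (lyap (A + B * F)ᵀ (C + D * F)ᵀ ^ k) X = 0 := by
    intro k
    have hk := h0 k
    rw [gainCost, add_mul, Matrix.trace_add] at hk
    have h1 := trace_mul_nonneg hQ (hpos k)
    have h2 := trace_mul_nonneg (posSemidef_transpose_mul_mul hR.posSemidef F) (hpos k)
    exact ⟨by linarith, mul_eq_zero_of_trace_eq_zero hR (hpos k) F (by linarith)⟩
  -- Zero cost means zero control: with `F Y = 0` and `Y F' = 0`, every term containing `F`
  -- disappears and the open-loop moments remain.
  have heq : ∀ k, (lyap (A + B * F)ᵀ (C + D * F)ᵀ ^ k) X = (lyap Aᵀ Cᵀ ^ k) X := by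
    intro k
    induction k with
    | zero => simp
    | succ k ih =>
      have hF := (hsplit k).2
      have hF' := congrArg Matrix.transpose hF
      rw [lyap_pow_succ', lyap_pow_succ', ← ih]
      set Y := (lyap (A + B * F)ᵀ (C + D * F)ᵀ ^ k) X
      rw [Matrix.transpose_mul, transpose_eq_of_posSemidef (hpos k), Matrix.transpose_zero] at hF'
      have h1 : ∀ G : Matrix (Fin n) (Fin n) ℝ, F * (Y * G) = 0 := fun G => by
        rw [← Matrix.mul_assoc, hF, Matrix.zero_mul]
      have h2 : ∀ G : Matrix (Fin m) (Fin n) ℝ, Y * (Fᵀ * G) = 0 := fun G => by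
        rw [← Matrix.mul_assoc, hF', Matrix.zero_mul]
      simp only [lyap_apply, Matrix.transpose_transpose, Matrix.transpose_add,
        Matrix.transpose_mul, Matrix.add_mul, Matrix.mul_add, Matrix.mul_assoc, h1, h2,
        Matrix.mul_zero, add_zero]
  simp only [heq] at hsplit ⊢
  exact h X hX fun k => (hsplit k).1

/-- The gain of a positive semidefinite solution of the Riccati equation is stabilizing. -/
lemma momentStable_riccatiGain (h : OutputDetectable A C Q) (hQ : Q.PosSemidef) (hR : R.PosDef)
    {P : Matrix (Fin n) (Fin n) ℝ} (hP : P.PosSemidef) (hPe : riccati A B C D Q R P = P) :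
    MomentStable (A + B * riccatiGain A B C D R P) (C + D * riccatiGain A B C D R P) :=
  momentStable_of_lyap_eq hP (posSemidef_gainCost hQ hR _)
    (hPe.symm.trans (riccati_eq_lyap hR hP)) (h.closedLoop hQ hR _)

/-- The difference of a closed-loop Lyapunov solution and a Riccati solution solves the Lyapunov
equation with source `gainExcess`. -/
lemma sub_eq_lyap_sub_add (hR : R.PosDef) {P : Matrix (Fin n) (Fin n) ℝ} (hP : P.PosSemidef)
    (hPe : riccati A B C D Q R P = P) {F : Matrix (Fin m) (Fin n) ℝ}
    {V : Matrix (Fin n) (Fin n) ℝ}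
    (hV : V = lyap (A + B * F) (C + D * F) V + gainCost Q R F) :
    V - P = lyap (A + B * F) (C + D * F) (V - P) + gainExcess A B C D R P F := by
  have h := lyap_add_gainCost (Q := Q) (A := A) (B := B) (C := C) (D := D) hR hP F
  rw [hPe] at h
  have h' := eq_sub_of_add_eq h.symm
  rw [map_sub]
  conv_lhs => rw [hV, h']
  abel

/-- The gain of `P'` is stabilizing with value `P'`, so `P' - P` solves a stable Lyapunov equation
with positive semidefinite source; the roles are then exchanged. -/
lemma eq_of_riccati_eq (h : OutputDetectable A C Q) (hQ : Q.PosSemidef) (hR : R.PosDef)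
    {P P' : Matrix (Fin n) (Fin n) ℝ} (hP : P.PosSemidef) (hPe : riccati A B C D Q R P = P)
    (hP' : P'.PosSemidef) (hPe' : riccati A B C D Q R P' = P') : P = P' := by
  have key : ∀ {P P' : Matrix (Fin n) (Fin n) ℝ}, P.PosSemidef → riccati A B C D Q R P = P →
      P'.PosSemidef → riccati A B C D Q R P' = P' → (P' - P).PosSemidef := by
    intro P P' hP hPe hP' hPe'
    refine (momentStable_riccatiGain h hQ hR hP' hPe').posSemidef_of_lyap_eq ?_
      (sub_eq_lyap_sub_add hR hP hPe (hPe'.symm.trans (riccati_eq_lyap hR hP')))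
      (posSemidef_gainExcess hR hP _)
    rw [Matrix.transpose_sub, transpose_eq_of_posSemidef hP, transpose_eq_of_posSemidef hP']
  exact sub_eq_zero.1 (eq_zero_of_posSemidef_neg (key hP' hPe' hP hPe)
    (by simpa using key hP hPe hP' hPe'))

lemma gainExcess_trace_nonneg (hR : R.PosDef) {P Z : Matrix (Fin n) (Fin n) ℝ}
    (hP : P.PosSemidef) (hZ : Z.PosSemidef) (F : Matrix (Fin m) (Fin n) ℝ) :
    0 ≤ (gainExcess A B C D R P F * Z).trace :=
  trace_mul_nonneg (posSemidef_gainExcess hR hP F) hZ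

lemma eq_riccatiGain_of_trace_eq_zero (hR : R.PosDef) {P Z : Matrix (Fin n) (Fin n) ℝ}
    (hP : P.PosSemidef) (hZ : Z.PosDef) {F : Matrix (Fin m) (Fin n) ℝ}
    (h : (gainExcess A B C D R P F * Z).trace = 0) : F = riccatiGain A B C D R P := by
  have h1 := mul_eq_zero_of_trace_eq_zero (posDef_riccatiWeight hR hP) hZ.posSemidef _ h
  have h2 := congrArg (· * Z⁻¹) h1
  simp only [Matrix.zero_mul, Matrix.mul_nonsing_inv_cancel_right _ _ hZ.det_pos.ne'.isUnit] at h2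
  exact sub_eq_zero.1 h2

end Riccati

/-! ### Reduction of the augmented equations to the state space. -/

section Augmented

variable {n m : ℕ} {A : Matrix (Fin n) (Fin n) ℝ} {B : Matrix (Fin n) (Fin m) ℝ}
  {C : Matrix (Fin n) (Fin n) ℝ} {D : Matrix (Fin n) (Fin m) ℝ}
  {Q : Matrix (Fin n) (Fin n) ℝ} {R : Matrix (Fin m) (Fin m) ℝ}

/-- The embedding `[I; F]` of the state into the augmented state. -/
def gainRows (F : Matrix (Fin m) (Fin n) ℝ) : Matrix (Fin n ⊕ Fin m) (Fin n) ℝ :=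
  Matrix.fromRows 1 F

lemma augInit_eq (Z : Matrix (Fin n) (Fin n) ℝ) (F : Matrix (Fin m) (Fin n) ℝ) :
    augInit Z F = gainRows F * Z * (gainRows F)ᵀ := rfl

lemma aug_eq (A : Matrix (Fin n) (Fin n) ℝ) (B : Matrix (Fin n) (Fin m) ℝ)
    (F : Matrix (Fin m) (Fin n) ℝ) :
    aug A B F = gainRows F * Matrix.fromCols A B := by
  simp [aug, gainRows]

lemma fromCols_mul_gain (A : Matrix (Fin n) (Fin n) ℝ) (B : Matrix (Fin n) (Fin m) ℝ)
    (F : Matrix (Fin m) (Fin n) ℝ) :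
    Matrix.fromCols A B * gainRows F = A + B * F := by
  simp [gainRows, Matrix.fromCols_mul_fromRows]

lemma gain_costMatrix_gain (Q : Matrix (Fin n) (Fin n) ℝ) (R : Matrix (Fin m) (Fin m) ℝ)
    (F : Matrix (Fin m) (Fin n) ℝ) :
    (gainRows F)ᵀ * costMatrix Q R * gainRows F = gainCost Q R F := by
  simp [gainRows, costMatrix, gainCost, Matrix.transpose_fromRows, Matrix.fromCols_mul_fromBlocks,
    Matrix.fromCols_mul_fromRows]

lemma isSymm_costMatrix (hQ : Q.PosSemidef) (hR : R.PosDef) : (costMatrix Q R).IsSymm := by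
  simp [costMatrix, Matrix.IsSymm, Matrix.fromBlocks_transpose, transpose_eq_of_posSemidef hQ,
    transpose_eq_of_posSemidef hR.posSemidef]

/-- The augmented value matrix built from a value matrix of the state. -/
def augValue (A : Matrix (Fin n) (Fin n) ℝ) (B : Matrix (Fin n) (Fin m) ℝ)
    (C : Matrix (Fin n) (Fin n) ℝ) (D : Matrix (Fin n) (Fin m) ℝ)
    (Q : Matrix (Fin n) (Fin n) ℝ) (R : Matrix (Fin m) (Fin m) ℝ)
    (V : Matrix (Fin n) (Fin n) ℝ) : Matrix (Fin n ⊕ Fin m) (Fin n ⊕ Fin m) ℝ :=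
  (Matrix.fromCols A B)ᵀ * V * Matrix.fromCols A B +
    (Matrix.fromCols C D)ᵀ * V * Matrix.fromCols C D + costMatrix Q R

lemma gain_augValue_gain (V : Matrix (Fin n) (Fin n) ℝ) (F : Matrix (Fin m) (Fin n) ℝ) :
    (gainRows F)ᵀ * augValue A B C D Q R V * gainRows F =
      lyap (A + B * F) (C + D * F) V + gainCost Q R F := by
  rw [lyap_apply, ← fromCols_mul_gain A B F, ← fromCols_mul_gain C D F, ← gain_costMatrix_gain]
  simp only [augValue, Matrix.mul_add, Matrix.add_mul, Matrix.transpose_mul, Matrix.mul_assoc]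

/-- Since `A_F = [I; F][A, B]`, and likewise for `C_F`, the equation sees `X` only through its
compression by `[I; F]`, which therefore determines `X`. -/
lemma p2_equation_iff {X : Matrix (Fin n ⊕ Fin m) (Fin n ⊕ Fin m) ℝ}
    {F : Matrix (Fin m) (Fin n) ℝ} :
    (aug A B F)ᵀ * X * aug A B F + (aug C D F)ᵀ * X * aug C D F + costMatrix Q R - X = 0 ↔
      X = augValue A B C D Q R ((gainRows F)ᵀ * X * gainRows F) := by
  rw [sub_eq_zero, eq_comm, aug_eq, aug_eq, augValue]
  simp only [Matrix.transpose_mul, Matrix.mul_assoc]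

lemma p2_value_eq {X : Matrix (Fin n ⊕ Fin m) (Fin n ⊕ Fin m) ℝ} {F : Matrix (Fin m) (Fin n) ℝ}
    (h : X = augValue A B C D Q R ((gainRows F)ᵀ * X * gainRows F)) :
    (gainRows F)ᵀ * X * gainRows F =
      lyap (A + B * F) (C + D * F) ((gainRows F)ᵀ * X * gainRows F) +
        gainCost Q R F := by
  rw [← gain_augValue_gain, ← h]

lemma p2Objective_eq (Z : Matrix (Fin n) (Fin n) ℝ)
    (X : Matrix (Fin n ⊕ Fin m) (Fin n ⊕ Fin m) ℝ) (F : Matrix (Fin m) (Fin n) ℝ) :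
    P2Objective Z X F = ((gainRows F)ᵀ * X * gainRows F * Z).trace := by
  rw [P2Objective, augInit_eq, Matrix.mul_assoc, Matrix.mul_assoc, Matrix.trace_mul_comm,
    Matrix.mul_assoc, Matrix.trace_mul_comm]

/-- Pairing each equation with the other unknown produces the same `lyap` term by adjointness. This
links the objectives of Problems I and II. -/
lemma trace_gainCost_mul {F : Matrix (Fin m) (Fin n) ℝ} {V Y Z : Matrix (Fin n) (Fin n) ℝ}
    (hV : V = lyap (A + B * F) (C + D * F) V + gainCost Q R F)
    (hY : Y = lyap (A + B * F)ᵀ (C + D * F)ᵀ Y + Z) :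
    (gainCost Q R F * Y).trace = (V * Z).trace := by
  have h1 := congrArg (fun G => (G * Y).trace) hV
  have h2 := congrArg (fun G => (V * G).trace) hY
  simp only [Matrix.add_mul, Matrix.mul_add, Matrix.trace_add, trace_mul_lyap] at h1 h2
  linarith

lemma gain_sandwich (F : Matrix (Fin m) (Fin n) ℝ) (Y Z : Matrix (Fin n) (Fin n) ℝ) :
    aug A B F * (gainRows F * Y * (gainRows F)ᵀ) * (aug A B F)ᵀ +
      aug C D F * (gainRows F * Y * (gainRows F)ᵀ) * (aug C D F)ᵀ +
        augInit Z F =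
      gainRows F * (lyap (A + B * F)ᵀ (C + D * F)ᵀ Y + Z) *
        (gainRows F)ᵀ := by
  rw [lyap_apply, ← fromCols_mul_gain A B F, ← fromCols_mul_gain C D F, aug_eq, aug_eq, augInit_eq]
  simp only [Matrix.mul_add, Matrix.add_mul, Matrix.transpose_mul, Matrix.transpose_transpose,
    Matrix.mul_assoc]

lemma trace_costMatrix_mul (F : Matrix (Fin m) (Fin n) ℝ) (Y : Matrix (Fin n) (Fin n) ℝ) :
    (costMatrix Q R * (gainRows F * Y * (gainRows F)ᵀ)).trace =
      (gainCost Q R F * Y).trace := by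
  rw [← gain_costMatrix_gain, ← Matrix.mul_assoc, Matrix.trace_mul_comm]
  simp only [Matrix.mul_assoc]

/-- The covariance equation of the augmented system reduces to that of the state. -/
lemma exists_of_p1_equation {S : Matrix (Fin n ⊕ Fin m) (Fin n ⊕ Fin m) ℝ}
    {F : Matrix (Fin m) (Fin n) ℝ} {Z : Matrix (Fin n) (Fin n) ℝ}
    (h : aug A B F * S * (aug A B F)ᵀ + aug C D F * S * (aug C D F)ᵀ + augInit Z F = S) :
    ∃ Y, S = gainRows F * Y * (gainRows F)ᵀ ∧
      Y = lyap (A + B * F)ᵀ (C + D * F)ᵀ Y + Z := by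
  obtain ⟨Y, hY⟩ : ∃ Y, Y = Matrix.fromCols A B * S * (Matrix.fromCols A B)ᵀ +
    Matrix.fromCols C D * S * (Matrix.fromCols C D)ᵀ + Z := ⟨_, rfl⟩
  have hS : S = gainRows F * Y * (gainRows F)ᵀ := by
    conv_lhs => rw [← h]
    simp only [hY, aug_eq, augInit_eq, Matrix.mul_add, Matrix.add_mul, Matrix.transpose_mul,
      Matrix.mul_assoc]
  refine ⟨Y, hS, ?_⟩
  rw [hS] at hY
  refine hY.trans ?_
  rw [lyap_apply, ← fromCols_mul_gain A B F, ← fromCols_mul_gain C D F]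
  simp only [Matrix.transpose_mul, Matrix.transpose_transpose, Matrix.mul_assoc]

end Augmented

/-! ### The expected cost as a trace. -/

section Cost

variable {Ω : Type*} [MeasurableSpace Ω] {μ : Measure Ω} [IsProbabilityMeasure μ] {n m r : ℕ}
  {w : ℕ → Ω → ℝ} {A : Matrix (Fin n) (Fin n) ℝ} {B : Matrix (Fin n) (Fin m) ℝ}
  {C : Matrix (Fin n) (Fin n) ℝ} {D : Matrix (Fin n) (Fin m) ℝ}
  {Q : Matrix (Fin n) (Fin n) ℝ} {R : Matrix (Fin m) (Fin m) ℝ}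

lemma costMatrix_quadratic (Q : Matrix (Fin n) (Fin n) ℝ) (R : Matrix (Fin m) (Fin m) ℝ)
    (F : Matrix (Fin m) (Fin n) ℝ) (x : Fin n → ℝ) :
    Sum.elim x (F *ᵥ x) ⬝ᵥ (costMatrix Q R *ᵥ Sum.elim x (F *ᵥ x)) =
      x ⬝ᵥ gainCost Q R F *ᵥ x := by
  have h : Sum.elim x (F *ᵥ x) = gainRows F *ᵥ x := by simp [gainRows]
  rw [h, ← gain_costMatrix_gain, ← Matrix.mulVec_mulVec, ← Matrix.mulVec_mulVec,
    Matrix.dotProduct_mulVec x, Matrix.vecMul_transpose]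

/-- Tonelli for nonnegative summands, so the identity holds in `[0, ∞]` for every gain, stabilizing
or not. -/
lemma cost_eq (hw : IsUnitWhiteNoise μ w) (hQ : Q.PosSemidef) (hR : R.PosDef)
    (z : Fin n → ℝ) (F : Matrix (Fin m) (Fin n) ℝ) :
    cost μ w A B C D Q R z F = ∑' k, ENNReal.ofReal (gainCost Q R F *
      (lyap (A + B * F)ᵀ (C + D * F)ᵀ ^ k) (Matrix.vecMulVec z z)).trace := by
  simp only [cost, costMatrix_quadratic]
  rw [lintegral_tsum]
  · exact tsum_congr fun k => lintegral_quadratic_traj hw _ _ z k (posSemidef_gainCost hQ hR F)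
  · exact fun k => (ENNReal.measurable_ofReal.comp ((measurable_quadratic _).comp
      (measurable_traj hw.measurable _ _ z k))).aemeasurable

lemma totalCost_eq (hw : IsUnitWhiteNoise μ w) (hQ : Q.PosSemidef) (hR : R.PosDef)
    (z : Fin r → Fin n → ℝ) {F : Matrix (Fin m) (Fin n) ℝ} {V : Matrix (Fin n) (Fin n) ℝ}
    (hF : MomentStable (A + B * F) (C + D * F))
    (hV : V = lyap (A + B * F) (C + D * F) V + gainCost Q R F) :
    totalCost μ w A B C D Q R z F = ENNReal.ofReal (V * initMatrix z).trace := by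
  have hM := posSemidef_gainCost hQ hR F
  have hnn : ∀ l k, 0 ≤ (gainCost Q R F * (lyap (A + B * F)ᵀ (C + D * F)ᵀ ^ k)
      (Matrix.vecMulVec (z l) (z l))).trace := fun l k =>
    trace_mul_nonneg hM (lyap_pow_posSemidef _ _ (posSemidef_vecMulVec _) k)
  have hsum := fun l => hF.hasSum_trace_mul hV (posSemidef_vecMulVec (z l))
  simp only [totalCost, cost_eq hw hQ hR]
  simp only [← ENNReal.ofReal_tsum_of_nonneg (hnn _) (hsum _).summable, (hsum _).tsum_eq]
  rw [← ENNReal.ofReal_sum_of_nonneg fun l _ => (hsum l).nonneg (hnn l), initMatrix,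
    Matrix.mul_sum, Matrix.trace_sum]

/-- The value of a stabilizing gain exceeds that of the Riccati gain. -/
lemma trace_add_gainExcess_le (hR : R.PosDef) {P V Z : Matrix (Fin n) (Fin n) ℝ}
    (hP : P.PosSemidef) (hPe : riccati A B C D Q R P = P) (hZ : Z.PosSemidef)
    {F : Matrix (Fin m) (Fin n) ℝ} (hF : MomentStable (A + B * F) (C + D * F))
    (hV : V = lyap (A + B * F) (C + D * F) V + gainCost Q R F) :
    (P * Z).trace + (gainExcess A B C D R P F * Z).trace ≤ (V * Z).trace := by
  have hs := hF.hasSum_trace_mul (sub_eq_lyap_sub_add hR hP hPe hV) hZ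
  -- The excess accumulated along the trajectory is at least its term at time zero, where the moment
  -- matrix is `Z` itself.
  have h0 := le_hasSum hs 0 fun k _ =>
    gainExcess_trace_nonneg hR hP (lyap_pow_posSemidef _ _ hZ k) F
  simp only [pow_zero, Module.End.one_apply, Matrix.sub_mul, Matrix.trace_sub] at h0
  linarith

end Cost

end SLQR

/-! ### Main theorem. -/

theorem mainTheorem4 {n m r : ℕ} {Ω : Type*} [MeasurableSpace Ω] (μ : Measure Ω)
    [IsProbabilityMeasure μ] (w : ℕ → Ω → ℝ) (hw : SLQR.IsUnitWhiteNoise μ w)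
    (A : Matrix (Fin n) (Fin n) ℝ) (B : Matrix (Fin n) (Fin m) ℝ)
    (C : Matrix (Fin n) (Fin n) ℝ) (D : Matrix (Fin n) (Fin m) ℝ)
    (Q : Matrix (Fin n) (Fin n) ℝ) (R : Matrix (Fin m) (Fin m) ℝ)
    (hQ : Q.PosSemidef) (hR : R.PosDef)
    (hstab : SLQR.Stabilizable μ w A B C D)
    (hobs : SLQR.ExactlyObservable μ w A C Q ∨ SLQR.ExactlyDetectable μ w A C Q)
    (z : Fin r → Fin n → ℝ) (hZ : (SLQR.initMatrix z).PosDef) :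
    ∃ (Fstar : Matrix (Fin m) (Fin n) ℝ) (Xstar : Matrix (Fin n ⊕ Fin m) (Fin n ⊕ Fin m) ℝ),
      -- `Fstar` is the optimal gain of Problem (SLQR), with its Riccati formula
      (∀ F, SLQR.IsSLQROptimal μ w A B C D Q R z F ↔ F = Fstar) ∧
      (∃ Pstar : Matrix (Fin n) (Fin n) ℝ,
        (∀ P, (P.PosSemidef ∧ SLQR.SolvesGARE A B C D Q R P) ↔ P = Pstar) ∧
        Fstar = SLQR.riccatiGain A B C D R Pstar) ∧
      -- `(Xstar, Fstar)` is the one and only optimal solution of Primal Problem II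
      (∀ X F, SLQR.IsP2Optimal μ w A B C D Q R (SLQR.initMatrix z) X F ↔
        X = Xstar ∧ F = Fstar) ∧
      -- the three optimal values agree
      SLQR.P2Value μ w A B C D Q R (SLQR.initMatrix z) =
        (SLQR.totalCost μ w A B C D Q R z Fstar : EReal) ∧
      (SLQR.totalCost μ w A B C D Q R z Fstar : EReal) =
        SLQR.P1Value μ w A B C D Q R (SLQR.initMatrix z) := by
  open SLQR in
  have hmem : ∀ F, F ∈ stabilizingGains μ w A B C D ↔ MomentStable (A + B * F) (C + D * F) :=
    fun F => asms_iff_momentStable hw _ _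
  have hdet : OutputDetectable A C Q := fun X hX h => tendsto_of_output_eq_zero hw hQ hobs hX h
  obtain ⟨F₀, hF₀⟩ := hstab
  obtain ⟨P, hP, hPe⟩ := exists_riccati_eq hQ hR ((hmem F₀).1 hF₀)
  set Z := initMatrix z
  set K := riccatiGain A B C D R P
  have hKs : MomentStable (A + B * K) (C + D * K) := momentStable_riccatiGain hdet hQ hR hP hPe
  have hKP : P = lyap (A + B * K) (C + D * K) P + gainCost Q R K :=
    hPe.symm.trans (riccati_eq_lyap hR hP)
  have hPZ : 0 ≤ (P * Z).trace := trace_mul_nonneg hP hZ.posSemidef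
  have hKcost : totalCost μ w A B C D Q R z K = ENNReal.ofReal (P * Z).trace :=
    totalCost_eq hw hQ hR z hKs hKP
  have hlow : ∀ {F V}, MomentStable (A + B * F) (C + D * F) →
      V = lyap (A + B * F) (C + D * F) V + gainCost Q R F → (P * Z).trace ≤ (V * Z).trace :=
    fun {F V} hF hV => by
      linarith [trace_add_gainExcess_le hR hP hPe hZ.posSemidef hF hV,
        gainExcess_trace_nonneg (A := A) (B := B) (C := C) (D := D) hR hP hZ.posSemidef F]
  have huniq : ∀ {F V}, MomentStable (A + B * F) (C + D * F) →
      V = lyap (A + B * F) (C + D * F) V + gainCost Q R F →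
      (V * Z).trace ≤ (P * Z).trace → F = K := fun {F V} hF hV hle => by
    refine eq_riccatiGain_of_trace_eq_zero hR hP hZ (le_antisymm ?_
      (gainExcess_trace_nonneg hR hP hZ.posSemidef F))
    linarith [trace_add_gainExcess_le hR hP hPe hZ.posSemidef hF hV]
  have hcoe : (totalCost μ w A B C D Q R z K : EReal) = ((P * Z).trace : EReal) := by
    rw [hKcost, EReal.coe_ennreal_ofReal, max_eq_left hPZ]
  let E := gainRows K
  let X₀ := augValue A B C D Q R P
  have hX₀E : Eᵀ * X₀ * E = P := (gain_augValue_gain P K).trans hKP.symm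
  have hX₀s : X₀.IsSymm := by
    simp only [X₀, augValue, Matrix.IsSymm, Matrix.transpose_add, Matrix.transpose_mul,
      Matrix.transpose_transpose, transpose_eq_of_posSemidef hP, Matrix.mul_assoc,
      (isSymm_costMatrix hQ hR).eq]
  have hX₀f : P2Feasible μ w A B C D Q R X₀ K :=
    ⟨hX₀s, p2_equation_iff.2 (by rw [hX₀E]), (hmem K).2 hKs⟩
  have hX₀o : P2Objective Z X₀ K = (P * Z).trace := by rw [p2Objective_eq, hX₀E]
  have hP2low : ∀ X F, P2Feasible μ w A B C D Q R X F → (P * Z).trace ≤ P2Objective Z X F :=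
    fun X F hf => by
      rw [p2Objective_eq]
      exact hlow ((hmem F).1 hf.2.2) (p2_value_eq (p2_equation_iff.1 hf.2.1))
  refine ⟨K, X₀, fun F => ⟨fun h => ?_, ?_⟩, ⟨P, fun P' => ⟨fun h => ?_, ?_⟩, rfl⟩,
    fun X F => ⟨fun h => ?_, ?_⟩, ?_, ?_⟩
  · have hF := (hmem F).1 h.1
    obtain ⟨V, -, hV⟩ := hF.exists_lyap_eq (posSemidef_gainCost hQ hR F)
    have hle := h.2 K ((hmem K).2 hKs)
    rw [hKcost, totalCost_eq hw hQ hR z hF hV, ENNReal.ofReal_le_ofReal_iff hPZ] at hle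
    exact huniq hF hV hle
  · rintro rfl
    refine ⟨(hmem K).2 hKs, fun F' hF' => ?_⟩
    have hF := (hmem F').1 hF'
    obtain ⟨V, -, hV⟩ := hF.exists_lyap_eq (posSemidef_gainCost hQ hR F')
    rw [hKcost, totalCost_eq hw hQ hR z hF hV]
    exact ENNReal.ofReal_le_ofReal (hlow hF hV)
  · exact eq_of_riccati_eq hdet hQ hR h.1 h.2 hP hPe
  · rintro rfl
    exact ⟨hP, hPe⟩
  · have hF := (hmem F).1 h.1.2.2
    have hX := p2_equation_iff.1 h.1.2.1
    have hle := h.2 X₀ K hX₀f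
    rw [hX₀o, p2Objective_eq] at hle
    obtain rfl := huniq hF (p2_value_eq hX) hle
    refine ⟨?_, rfl⟩
    -- Feasibility gives only symmetry of `X`. The difference of the two value matrices solves the
    -- homogeneous Lyapunov equation of a stable loop, so it and its negative are positive
    -- semidefinite, hence zero.
    have hs : (Eᵀ * X * E - P)ᵀ = Eᵀ * X * E - P := by
      simp [Matrix.transpose_mul, transpose_eq_of_posSemidef hP, h.1.1.eq, Matrix.mul_assoc]
    have he := sub_eq_lyap_sub_add hR hP hPe (p2_value_eq hX)
    rw [gainExcess_riccatiGain] at he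
    have h1 := hKs.posSemidef_of_lyap_eq hs he Matrix.PosSemidef.zero
    have h2 : (-(Eᵀ * X * E - P)).PosSemidef := by
      refine hKs.posSemidef_of_lyap_eq (M := 0) (by rw [Matrix.transpose_neg, hs]) ?_
        Matrix.PosSemidef.zero
      rw [map_neg, add_zero]
      rw [add_zero] at he
      exact congrArg Neg.neg he
    have hVP := sub_eq_zero.1 (eq_zero_of_posSemidef_neg h1 h2)
    exact hX.trans (congrArg (augValue A B C D Q R) hVP)
  · rintro ⟨rfl, rfl⟩
    exact ⟨hX₀f, fun X' F' hf => hX₀o ▸ hP2low X' F' hf⟩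
  · rw [hcoe]
    refine le_antisymm (iInf_le_of_le X₀ (iInf_le_of_le K (iInf_le_of_le hX₀f ?_))) ?_
    · rw [hX₀o]
    · exact le_iInf fun X => le_iInf fun F => le_iInf fun hf =>
        EReal.coe_le_coe_iff.2 (hP2low X F hf)
  · rw [hcoe]
    refine le_antisymm (le_iInf fun S => le_iInf fun F => le_iInf fun hf =>
      EReal.coe_le_coe_iff.2 ?_) ?_
    · have hF := (hmem F).1 hf.2.2
      obtain ⟨V, -, hV⟩ := hF.exists_lyap_eq (posSemidef_gainCost hQ hR F)
      -- `Y` need not be known to be positive semidefinite: duality with `V` already evaluates the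
      -- objective as `Tr(VZ)`.
      obtain ⟨Y, rfl, hY⟩ := exists_of_p1_equation hf.2.1
      rw [trace_costMatrix_mul, trace_gainCost_mul hV hY]
      exact hlow hF hV
    · obtain ⟨Y, hYp, hY⟩ := hKs.exists_dual_lyap_eq hZ.posSemidef
      have hf : P1Feasible μ w A B C D Z (E * Y * Eᵀ) K := by
        refine ⟨?_, ?_, (hmem K).2 hKs⟩
        · simp [Matrix.IsSymm, Matrix.transpose_mul, transpose_eq_of_posSemidef hYp,
            Matrix.mul_assoc]
        · rw [gain_sandwich, ← hY]
      refine iInf_le_of_le _ (iInf_le_of_le K (iInf_le_of_le hf ?_))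
      rw [trace_costMatrix_mul, trace_gainCost_mul hKP hY]
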